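/- Let $\mathbb G$ be an $n$-dimensional $k$-step Carnot group, i.e. a connected, simply connected Lie group whose Lie algebra is stratified, $\mathfrak g=H_1\oplus\dots\oplus H_k$, $[H_1,H_{j}]=H_{j+1}$ $(1\le j<k)$, $[H_1,H_k]=0$. Fix a left-invariant Riemannian metric for which the layers are orthogonal and an orthonormal left-invariant frame $X_1,\dots,X_n$ adapted to the stratification; $H$ is the horizontal subbundle spanned by the $X_i\in H_1$ and $V$ the vertical one, spanned by the $X_\alpha\in H_2\oplus\dots\oplus H_k$. Vector fields along curves are identified with their components in this frame, and are differentiated componentwise. Put $C^\alpha_{IJ}=\langle[X_I,X_J],X_\alpha\rangle$, $C(Z)=\sum_{X_\alpha\in V}Z_\alpha\,[C^\alpha_{IJ}]_{I,J=1,\dots,n}$ and $C_H(Z)=\sum_{X_\alpha\in H_2}Z_\alpha\,[C^\alpha_{ij}]_{X_i,X_j\in H}$. Let $d$ be the Carnot–Carathéodory distance and $S(x_0,t)=\{y: d(x_0,y)=t\}$. Assume that $\mathbb G$ has no strictly abnormal minimizers (that is, every minimizer, parametrized by arc length, that is an abnormal curve is also a normal curve). Let $r>0$ and let $x(t)=\exp_{SR}(x_0,P_0)(t)$,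 $t\in[0,r]$, be a unit-speed normal CC-geodesic: $x$ is the first component of the solution $(x,P)$ of $\dot x=P_H$, $\dot P=-C(P_V)P_H$ with $x(0)=x_0$, $P(0)=P_0$, $|(P_0)_H|=1$. At a regular non-characteristic point $y$ of $S(x_0,t)$, $t>0$ (that is, $y\in S(x_0,t)$, near $y$ the sphere is a $C^1$-smooth hypersurface, and its Riemannian unit normal $\nu$ at $y$, chosen to point out of the ball $\{d(x_0,\cdot)<t\}$, has non-zero horizontal part $\nu^{(H)}$), put $\nu_H=\nu^{(H)}/|\nu^{(H)}|$ and $\varpi=\nu^{(V)}/|\nu^{(H)}|$, where $\nu^{(V)}$ is the vertical part of $\nu$. (i) If $t\in(0,r]$ and $x(t)$ is a regular non-characteristic point of $S(x_0,t)$, then $\frac{dx}{dt}(t)=\nu_H$. In particular $x$ meets $S(x_0,t)$ horizontally-orthogonally: $\dot x(t)$ is orthogonal to every horizontal vector tangent to $S(x_0,t)$ at $x(t)$. (ii) If $t\in(0,r]$ and $x(s)$ is a regular non-characteristic point of $S(x_0,s)$ for all $s\in(0,r]$ near $t$, then $\nu_H$ and $\varpi$, taken at the point $x(s)$ of $S(x_0,s)$,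 are differentiable in $s$ at $s=t$ and $$\frac{d\nu_H}{dt}=-C_H(\varpi)\,\nu_H,\qquad \frac{d\varpi}{dt}=-\big(C(\varpi)\,\nu_H\big)_V ,$$ where $(\cdot)_V$ denotes the vertical part. (Derivatives at $t=r$ are one-sided.) -/

import Mathlib

open Set Filter MeasureTheory
open scoped Manifold ContDiff Topology ENNReal Matrix

noncomputable section

/-- A stratification `𝔤 = H₁ ⊕ … ⊕ H_k` of the Lie algebra of the Lie group `G`, together with a
left-invariant Riemannian metric making the layers mutually orthogonal. Both are recorded by a graded
orthonormal frame: the basis vectors `X_I` with `ord I = j` span `H_j`, and the metric is the one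
for which the left-invariant frame `X_1, …, X_n` is orthonormal. Tangent vectors of `G` are
written in the components `ξ : Fin n → ℝ` with respect to this frame. -/
structure CarnotStructure (E : Type*) [NormedAddCommGroup E] [NormedSpace ℝ E]
    (G : Type*) [TopologicalSpace G] [ChartedSpace E G] [Group G] (n k : ℕ) where
  /-- the graded frame -/
  basis : Module.Basis (Fin n) ℝ (GroupLieAlgebra 𝓘(ℝ, E) G)
  /-- the layer to which an element of the frame belongs -/
  ord : Fin n → ℕ
  one_le_ord : ∀ I, 1 ≤ ord I
  ord_le : ∀ I, ord I ≤ k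
  exists_ord_eq : ∃ I, ord I = k
  /-- `[H₁, H_j] = H_{j+1}` for every `j ≥ 1` (where `H_{k+1} = 0`) -/
  bracket_layer : ∀ j, 1 ≤ j →
    Submodule.span ℝ {z | ∃ v ∈ Submodule.span ℝ (basis '' {I | ord I = 1}),
        ∃ w ∈ Submodule.span ℝ (basis '' {I | ord I = j}), z = ⁅v, w⁆} =
      Submodule.span ℝ (basis '' {I | ord I = j + 1})

namespace CarnotStructure

variable {E : Type*} [NormedAddCommGroup E] [NormedSpace ℝ E]
  {G : Type*} [TopologicalSpace G] [ChartedSpace E G] [Group G] {n k : ℕ}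
  (F : CarnotStructure E G n k)

/-! ### Linear algebra in the frame -/

/-- Horizontal part of a vector. -/
def projH (ξ : Fin n → ℝ) : Fin n → ℝ := fun I => if F.ord I = 1 then ξ I else 0

/-- Vertical part of a vector. -/
def projV (ξ : Fin n → ℝ) : Fin n → ℝ := fun I => if F.ord I = 1 then 0 else ξ I

/-- Norm of a vector for the metric that makes the frame orthonormal. -/
def len (ξ : Fin n → ℝ) : ℝ := Real.sqrt (∑ I, ξ I ^ 2)

/-- Structural constants: the matrix `C^R = [C^R_{IJ}]` with `C^R_{IJ} = ⟨[X_I, X_J], X_R⟩`. -/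
def structMatrix (R : Fin n) : Matrix (Fin n) (Fin n) ℝ :=
  Matrix.of fun I J => F.basis.repr ⁅F.basis I, F.basis J⁆ R

/-- `C(Z) = ∑_α Z_α C^α`, where `α` runs over the vertical indices. -/
def C (Z : Fin n → ℝ) : Matrix (Fin n) (Fin n) ℝ :=
  ∑ α with F.ord α ≠ 1, Z α • F.structMatrix α

/-- `C_H(Z) = ∑_α Z_α C_H^α`, where `α` runs over the indices of the second layer and
`C_H^α` is the horizontal block of `C^α` (here filled up with zeros to an `n × n` matrix). -/
def CH (Z : Fin n → ℝ) : Matrix (Fin n) (Fin n) ℝ :=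
  ∑ α with F.ord α = 2, Z α • Matrix.of fun I J =>
    if F.ord I = 1 ∧ F.ord J = 1 then F.structMatrix α I J else 0

/-! ### Curves, CC-distance, CC-spheres -/

/-- Value at `g` of the left-invariant vector field `∑_I ξ_I X_I`. -/
def leftField (ξ : Fin n → ℝ) (g : G) : TangentSpace 𝓘(ℝ, E) g :=
  mulInvariantVectorField (I := 𝓘(ℝ, E)) (∑ I, ξ I • F.basis I) g

/-- The curve `γ`, restricted to `s`, has at time `t` the velocity `∑_I ξ_I X_I(γ(t))`. -/
def HasVelocityWithinAt (γ : ℝ → G) (ξ : Fin n → ℝ) (s : Set ℝ) (t : ℝ) : Prop :=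
  HasMFDerivWithinAt 𝓘(ℝ, ℝ) 𝓘(ℝ, E) γ s t
    ((1 : ℝ →L[ℝ] ℝ).smulRight (F.leftField ξ (γ t)))

/-- A `C¹` horizontal curve on `[a, b]` with velocity `u`. -/
structure IsHorizontalArc (γ : ℝ → G) (u : ℝ → Fin n → ℝ) (a b : ℝ) : Prop where
  le : a ≤ b
  continuousOn : ContinuousOn u (Icc a b)
  horizontal : ∀ t ∈ Icc a b, F.projV (u t) = 0
  hasVelocity : ∀ t ∈ Icc a b, F.HasVelocityWithinAt γ (u t) (Icc a b) t

/-- `F.Joined p q ℓ`: some piecewise smooth horizontal path of length `ℓ` leads from `p` to `q`. -/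
inductive Joined : G → G → ℝ → Prop
  | refl (p : G) : Joined p p 0
  | append (p : G) (ℓ : ℝ) (γ : ℝ → G) (u : ℝ → Fin n → ℝ) (a b : ℝ) :
      Joined p (γ a) ℓ → F.IsHorizontalArc γ u a b →
        Joined p (γ b) (ℓ + ∫ t in a..b, len (u t))

/-- The Carnot–Carathéodory distance: the infimum of the lengths of the piecewise smooth
horizontal paths from `p` to `q`. -/
def ccDist (p q : G) : ℝ≥0∞ := ⨅ (ℓ : ℝ) (_ : F.Joined p q ℓ), ENNReal.ofReal ℓ

/-- The CC-sphere with centre `x₀` and radius `t`. -/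
def ccSphere (x₀ : G) (t : ℝ) : Set G := {y | F.ccDist x₀ y = ENNReal.ofReal t}

/-! ### Normal and abnormal curves -/

/-- `(γ, P)` solves on `[a, b]` the normal geodesic equations `ẋ = P_H`, `Ṗ = - C(P_V) P_H`
(Hamilton's equations of `½ ∑_{i ∈ I_H} P_i²` written in the momentum functions `P_I`). -/
def IsNormalExtremal (γ : ℝ → G) (P : ℝ → Fin n → ℝ) (a b : ℝ) : Prop :=
  ∀ t ∈ Icc a b, F.HasVelocityWithinAt γ (F.projH (P t)) (Icc a b) t ∧
    HasDerivWithinAt P (-(F.C (F.projV (P t)) *ᵥ F.projH (P t))) (Icc a b) t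

/-- A normal curve is the projection of a solution of the normal geodesic equations. -/
def IsNormalCurve (γ : ℝ → G) (a b : ℝ) : Prop := ∃ P, F.IsNormalExtremal γ P a b

/-- An absolutely continuous horizontal curve on `[a, b]` with velocity `u`; a curve in a
manifold is absolutely continuous if its composition with each smooth function is. -/
structure IsHorizontalAC (γ : ℝ → G) (u : ℝ → Fin n → ℝ) (a b : ℝ) : Prop where
  absolutelyContinuous : ∀ φ : G → ℝ, ContMDiff 𝓘(ℝ, E) 𝓘(ℝ, ℝ) ∞ φ →
    AbsolutelyContinuousOnInterval (fun t => φ (γ t)) a b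
  horizontal : ∀ t ∈ Icc a b, F.projV (u t) = 0
  hasVelocity : ∀ᵐ t ∂volume.restrict (Icc a b), F.HasVelocityWithinAt γ (u t) univ t

/-- The canonical symplectic form `-dΘ` of `T^*G` at a covector with components `P`, evaluated on
two tangent vectors of `T^*G`. In the trivialization by the left-invariant frame a tangent vector
is a pair `(ξ, η)` of a velocity `ξ` in `G` and a velocity `η` of the components of the covector;
`Θ = ∑_R P_R ω_R` and `dω_R(X_I, X_J) = -C^R_{IJ}`. -/
def symplecticForm (P ξ η ξ' η' : Fin n → ℝ) : ℝ :=
  η' ⬝ᵥ ξ - η ⬝ᵥ ξ' + ∑ R, P R * (ξ ⬝ᵥ (F.structMatrix R *ᵥ ξ'))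

/-- `P` lifts a horizontal curve with velocity `u` to the annihilator of `H` in `T^*G` (the covectors
with `P_H = 0`): it is absolutely continuous with square integrable derivative, it avoids the
zero section, and its derivative lies in the kernel of the symplectic form restricted
to the annihilator. -/
structure IsAbnormalLift (u : ℝ → Fin n → ℝ) (P : ℝ → Fin n → ℝ) (a b : ℝ) : Prop where
  annihilator : ∀ t ∈ Icc a b, F.projH (P t) = 0
  ne_zero : ∀ t ∈ Icc a b, P t ≠ 0
  absolutelyContinuous : ∀ I, AbsolutelyContinuousOnInterval (fun t => P t I) a b
  squareIntegrable : ∀ I, MemLp (deriv fun t => P t I) 2 (volume.restrict (Icc a b))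
  kernel : ∀ᵐ t ∂volume.restrict (Icc a b), ∀ ξ' η' : Fin n → ℝ, F.projH η' = 0 →
    F.symplecticForm (P t) (u t) (deriv P t) ξ' η' = 0

/-- An abnormal curve. -/
def IsAbnormalCurve (γ : ℝ → G) (a b : ℝ) : Prop :=
  ∃ u P, F.IsHorizontalAC γ u a b ∧ (∀ I, MemLp (fun t => u t I) 2 (volume.restrict (Icc a b))) ∧
    F.IsAbnormalLift u P a b

/-- A minimizer on `[a, b]`, parametrized by arc length: an absolutely continuous
horizontal curve of unit speed which locally minimizes the length between its points. -/
def IsUnitSpeedMinimizer (γ : ℝ → G) (a b : ℝ) : Prop :=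
  (∃ u, F.IsHorizontalAC γ u a b ∧ ∀ᵐ t ∂volume.restrict (Icc a b), len (u t) = 1) ∧
  ∀ t ∈ Icc a b, ∃ ε > 0, ∀ t₀ ∈ Icc a b ∩ Ioo (t - ε) (t + ε),
    ∀ t₁ ∈ Icc a b ∩ Ioo (t - ε) (t + ε), t₀ ≤ t₁ →
      F.ccDist (γ t₀) (γ t₁) = ENNReal.ofReal (t₁ - t₀)

/-- There are no strictly abnormal minimizers: a minimizer that is abnormal is also normal.
Minimizers are parametrized by arc length here, because normal curves have constant speed. -/
def NoStrictlyAbnormalMinimizers : Prop :=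
  ∀ (a b : ℝ) (γ : ℝ → G), a < b → F.IsUnitSpeedMinimizer γ a b → F.IsAbnormalCurve γ a b →
    F.IsNormalCurve γ a b

/-! ### Normals of CC-spheres -/

/-- Components in the frame of the Riemannian gradient: `(grad f)_I = X_I f`. -/
def grad (f : G → ℝ) (y : G) : Fin n → ℝ := fun I =>
  mfderiv 𝓘(ℝ, E) 𝓘(ℝ, ℝ) f y
    (mulInvariantVectorField (I := 𝓘(ℝ, E)) (F.basis I) y)

/-- Near its point `y`, the set `S` is the `C¹`-smooth hypersurface `{f = 0}`. -/
structure IsDefiningFunctionAt (S : Set G) (f : G → ℝ) (y : G) : Prop where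
  mem : y ∈ S
  contMDiffAt : ContMDiffAt 𝓘(ℝ, E) 𝓘(ℝ, ℝ) 1 f y
  grad_ne_zero : F.grad f y ≠ 0
  eventually_iff : ∀ᶠ z in 𝓝 y, z ∈ S ↔ f z = 0

/-- `y` is a regular point of the CC-sphere `S(x₀, t)`, that is, the sphere is a `C¹`-smooth
hypersurface near `y ∈ S(x₀, t)`, and `ν` is its Riemannian unit normal at `y`, pointing out of
the ball. -/
def IsOuterUnitNormal (x₀ : G) (t : ℝ) (y : G) (ν : Fin n → ℝ) : Prop :=
  ∃ f : G → ℝ, F.IsDefiningFunctionAt (F.ccSphere x₀ t) f y ∧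
    (∀ᶠ z in 𝓝 y, F.ccDist x₀ z < ENNReal.ofReal t → f z < 0) ∧
    ν = (len (F.grad f y))⁻¹ • F.grad f y

/-- `y` is a regular non-characteristic point of `S(x₀, t)`, with outer unit normal `ν`. -/
def IsNoncharNormal (x₀ : G) (t : ℝ) (y : G) (ν : Fin n → ℝ) : Prop :=
  F.IsOuterUnitNormal x₀ t y ν ∧ F.projH ν ≠ 0

/-- The horizontal unit normal `ν_H = P_H ν / |P_H ν|`. -/
def horNormal (ν : Fin n → ℝ) : Fin n → ℝ := (len (F.projH ν))⁻¹ • F.projH ν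

/-- The vertical part `ϖ = P_V ν / |P_H ν|` of the normal. -/
def vertNormal (ν : Fin n → ℝ) : Fin n → ℝ := (len (F.projH ν))⁻¹ • F.projV ν

end CarnotStructure

end

/-!
The proof compares the CC-balls around `x₀` with left translates of horizontal curves. It uses
neither Pontryagin's principle nor a dichotomy between normal and abnormal minimizers.

For the first part, leave `x` at time `t - h` and follow for a time `h` the left-invariant field of
a horizontal vector `ξ` of length less than one. The endpoint lies in the open ball of radius `t`,
where the defining function of the sphere is negative, so `⟨ξ - ẋ(t), ν⟩ ≤ 0`
(`sub_dotProduct_normal_nonpos`). Hence the unit vector `ẋ(t) = P_H(t)` maximizes `⟨·, ν⟩` over the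
horizontal unit ball, which makes it equal to `ν_H` (`projH_eq_horNormal`).

For the second part, let `s ≤ s'` and `g = x(s)⁻¹ x(s')`. If `z` lies in `S(x₀, s)`, then
`τ ↦ z x(s)⁻¹ x(τ)`, `s ≤ τ ≤ s'`, is a horizontal curve of length `s' - s` from `z` to `z g`, so
right multiplication by `g` maps `S(x₀, s)` into the closed ball of radius `s'`, and it maps `x(s)`
to the boundary point `x(s')`. The Lagrange multiplier rule shows that the normal at `x(s)` is a
multiple of the pull-back of the normal at `x(s')` (`exists_normal_eq_smul_comp_Ad`); in the left
trivialization this pull-back is the transpose of `Ad (x(s')⁻¹ x(s))`. Thus near a fixed `t` the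
covector `ν_H + ϖ` at `x(s)` is a multiple of `q(s) = Ad (x(t)⁻¹ x(s))ᵀ (ν_H + ϖ)(t)`. The
derivative of `Ad` at the identity is the bracket (`hasDerivWithinAt_Ad`), so `q' = -C(ϖ) ν_H` at `t`. As
`ν_H + ϖ` has inner product one with `P_H`, the factor is `1 / ⟨q, P_H⟩`, and this is stationary at
`t` because the matrices `C(Z)` are skew. Therefore `(ν_H + ϖ)' = -C(ϖ) ν_H`
(`hasDerivWithinAt_scaledNormal`), and the two equations are its horizontal and vertical parts.
-/

noncomputable section

namespace LieGroupChart

/-! ### A Lie group in coordinates around its identity -/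

variable {E : Type*} [NormedAddCommGroup E] [NormedSpace ℝ E]
  {G : Type*} [TopologicalSpace G] [ChartedSpace E G] [Group G]

/-- The preferred chart at the identity of a Lie group; its values away from the domain of the chart
have no meaning. -/
def coord (g : G) : E := extChartAt 𝓘(ℝ, E) (1 : G) g

variable (G) in
/-- The inverse of the chart `coord`, meaningful near `origin G`. -/
def param (a : E) : G := (extChartAt 𝓘(ℝ, E) (1 : G)).symm a

variable (G) in
/-- The coordinates of the identity. -/
def origin : E := coord (1 : G)

variable (G) in
/-- The group multiplication, in coordinates near the identity. -/
def localMul (z : E × E) : E := coord (param G z.1 * param G z.2)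

/-- Conjugation by `h`, in coordinates near the identity. -/
def localConj (h : G) (a : E) : E := coord (h * param G a * h⁻¹)

/-- The adjoint action of `h` on the tangent space at the identity. Defining it through `localConj`
makes it a linear map of the model space, so that its dependence on `h` can be differentiated
without comparing tangent spaces at different points. -/
def Ad (h : G) : E →L[ℝ] E := fderiv ℝ (localConj h) (origin G)

@[simp] lemma param_origin : param G (origin G : E) = 1 := by
  simp [param, origin, coord]

lemma coord_one : (coord (1 : G) : E) = origin G := rfl

lemma eventually_param_coord : ∀ᶠ g in 𝓝 (1 : G), param G (coord g : E) = g := by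
  filter_upwards [extChartAt_source_mem_nhds (I := 𝓘(ℝ, E)) (1 : G)] with g hg
  exact (extChartAt 𝓘(ℝ, E) (1 : G)).left_inv hg

lemma eventually_coord_param : ∀ᶠ a in 𝓝 (origin G : E), coord (param G a) = a := by
  filter_upwards [extChartAt_target_mem_nhds (I := 𝓘(ℝ, E)) (1 : G)] with a ha
  exact (extChartAt 𝓘(ℝ, E) (1 : G)).right_inv ha

lemma contMDiffAt_coord : ContMDiffAt 𝓘(ℝ, E) 𝓘(ℝ, E) ∞ (coord : G → E) 1 :=
  contMDiffAt_extChartAt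

lemma tendsto_coord : Tendsto (coord : G → E) (𝓝 1) (𝓝 (origin G)) :=
  (contMDiffAt_coord (E := E) (G := G)).continuousAt

@[simp] lemma localConj_origin (h : G) : localConj h (origin G) = (origin G : E) := by
  simp [localConj, coord_one]

lemma Ad_one : (Ad (1 : G) : E →L[ℝ] E) = ContinuousLinearMap.id ℝ E := by
  have : (localConj (1 : G) : E → E) =ᶠ[𝓝 (origin G)] id := by
    filter_upwards [eventually_coord_param (E := E) (G := G)] with a ha
    simp [localConj, ha]
  rw [Ad, this.fderiv_eq, fderiv_id]

lemma localMul_origin_left : ∀ᶠ a in 𝓝 (origin G : E), localMul G (origin G, a) = a := by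
  filter_upwards [eventually_coord_param (E := E) (G := G)] with a ha
  simp [localMul, ha]

lemma localMul_origin_right : ∀ᶠ a in 𝓝 (origin G : E), localMul G (a, origin G) = a := by
  filter_upwards [eventually_coord_param (E := E) (G := G)] with a ha
  simp [localMul, ha]

lemma tendsto_prod_origin_right :
    Tendsto (fun a : E => (a, (origin G : E))) (𝓝 (origin G)) (𝓝 (origin G, origin G)) := by
  have : Continuous (fun a : E => (a, (origin G : E))) := by fun_prop
  exact this.tendsto _

lemma tendsto_prod_origin_left :
    Tendsto (fun a : E => ((origin G : E), a)) (𝓝 (origin G)) (𝓝 (origin G, origin G)) := by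
  have : Continuous (fun a : E => ((origin G : E), a)) := by fun_prop
  exact this.tendsto _

/-- Chain rule for boundaryless manifolds. The intermediate point is given up to equality and the
derivatives are linear maps of the model spaces, which avoids casts between tangent spaces. -/
lemma hasMFDerivAt_comp_of_eq {E₁ E₂ E₃ : Type*} [NormedAddCommGroup E₁] [NormedSpace ℝ E₁]
    [NormedAddCommGroup E₂] [NormedSpace ℝ E₂] [NormedAddCommGroup E₃] [NormedSpace ℝ E₃]
    {M₁ M₂ M₃ : Type*} [TopologicalSpace M₁] [ChartedSpace E₁ M₁]
    [TopologicalSpace M₂] [ChartedSpace E₂ M₂] [TopologicalSpace M₃] [ChartedSpace E₃ M₃]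
    {g : M₂ → M₃} {f : M₁ → M₂} {x : M₁} {y : M₂} {g' : E₂ →L[ℝ] E₃} {f' : E₁ →L[ℝ] E₂}
    (hg : HasMFDerivAt 𝓘(ℝ, E₂) 𝓘(ℝ, E₃) g y g') (hf : HasMFDerivAt 𝓘(ℝ, E₁) 𝓘(ℝ, E₂) f x f')
    (h : f x = y) : HasMFDerivAt 𝓘(ℝ, E₁) 𝓘(ℝ, E₃) (fun z => g (f z)) x (g'.comp f') := by
  subst h
  exact HasMFDerivAt.comp x hg hf

variable [LieGroup 𝓘(ℝ, E) ∞ G]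

lemma contMDiffAt_param : ContMDiffAt 𝓘(ℝ, E) 𝓘(ℝ, E) ∞ (param G : E → G) (origin G) :=
  (contMDiffOn_extChartAt_symm (I := 𝓘(ℝ, E)) (1 : G)).contMDiffAt
    (extChartAt_target_mem_nhds (I := 𝓘(ℝ, E)) (1 : G))

lemma hasMFDerivAt_coord : HasMFDerivAt 𝓘(ℝ, E) 𝓘(ℝ, E) (coord : G → E) 1
    (ContinuousLinearMap.id ℝ E) := by
  have : IsManifold 𝓘(ℝ, E) 1 G := IsManifold.of_le (n := ∞) (by simp)
  have h := (contMDiffAt_coord (E := E) (G := G)).mdifferentiableAt (by simp) |>.hasMFDerivAt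
  have e := mfderiv_extChartAt_self (I := 𝓘(ℝ, E)) (x := (1 : G))
  unfold coord at *
  rw [e] at h
  exact h

lemma hasMFDerivAt_param : HasMFDerivAt 𝓘(ℝ, E) 𝓘(ℝ, E) (param G : E → G) (origin G)
    (ContinuousLinearMap.id ℝ E) := by
  have : IsManifold 𝓘(ℝ, E) 1 G := IsManifold.of_le (n := ∞) (by simp)
  have h := (contMDiffAt_param (E := E) (G := G)).mdifferentiableAt (by simp) |>.hasMFDerivAt
  have e := mfderivWithin_range_extChartAt_symm (I := 𝓘(ℝ, E)) (x := (1 : G))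
  simp only [modelWithCornersSelf_coe, range_id, mfderivWithin_univ] at e
  unfold param origin coord at *
  rw [e] at h
  exact h

lemma hasMFDerivAt_mul_left (g h : G) : HasMFDerivAt 𝓘(ℝ, E) 𝓘(ℝ, E) (g * ·) h
    (mfderiv 𝓘(ℝ, E) 𝓘(ℝ, E) (g * ·) h) :=
  ((contMDiff_mul_left (I := 𝓘(ℝ, E)) (n := ∞) (a := g)).mdifferentiableAt
    (x := h) (by simp)).hasMFDerivAt

lemma tendsto_param : Tendsto (param G) (𝓝 (origin G : E)) (𝓝 1) := by
  have := (contMDiffAt_param (E := E) (G := G)).continuousAt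
  simpa [ContinuousAt] using this

lemma contDiffAt_localMul : ContDiffAt ℝ ∞ (localMul G : E × E → E) (origin G, origin G) := by
  rw [← contMDiffAt_iff_contDiffAt]
  have h1 : ContMDiffAt 𝓘(ℝ, E × E) 𝓘(ℝ, E) ∞ (fun z : E × E => param G z.1)
      (origin G, origin G) :=
    ContMDiffAt.comp (x := ((origin G, origin G) : E × E))
      (contMDiffAt_param (E := E) (G := G)) contDiff_fst.contMDiff.contMDiffAt
  have h2 : ContMDiffAt 𝓘(ℝ, E × E) 𝓘(ℝ, E) ∞ (fun z : E × E => param G z.2)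
      (origin G, origin G) :=
    ContMDiffAt.comp (x := ((origin G, origin G) : E × E))
      (contMDiffAt_param (E := E) (G := G)) contDiff_snd.contMDiff.contMDiffAt
  refine ContMDiffAt.comp_of_eq (y := 1) contMDiffAt_coord (h1.mul h2) (by simp)

lemma contDiffAt_localConj (h : G) : ContDiffAt ℝ ∞ (localConj h : E → E) (origin G) := by
  rw [← contMDiffAt_iff_contDiffAt]
  refine ContMDiffAt.comp_of_eq (y := 1) contMDiffAt_coord
    ((contMDiffAt_const.mul contMDiffAt_param).mul contMDiffAt_const) (by simp)

lemma hasFDerivAt_localConj (h : G) : HasFDerivAt (localConj h : E → E) (Ad h) (origin G) :=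
  ((contDiffAt_localConj h).differentiableAt (by simp)).hasFDerivAt

lemma tendsto_localConj (h : G) : Tendsto (localConj h) (𝓝 (origin G : E)) (𝓝 (origin G)) := by
  simpa [ContinuousAt] using (contDiffAt_localConj (E := E) h).continuousAt

lemma eventually_param_localConj (h : G) :
    ∀ᶠ a in 𝓝 (origin G : E), param G (localConj h a) = h * param G a * h⁻¹ := by
  have : Tendsto (fun a : E => h * param G a * h⁻¹) (𝓝 (origin G : E)) (𝓝 1) := by
    have hc : IsTopologicalGroup G := topologicalGroup_of_lieGroup 𝓘(ℝ, E) ∞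
    simpa using ((tendsto_param (E := E) (G := G)).const_mul h).mul_const h⁻¹
  exact this.eventually eventually_param_coord

lemma Ad_mul (h k : G) : (Ad (h * k) : E →L[ℝ] E) = (Ad h).comp (Ad k) := by
  have e : (localConj (h * k) : E → E) =ᶠ[𝓝 (origin G)] localConj h ∘ localConj k := by
    filter_upwards [eventually_param_localConj (E := E) k] with a ha
    simp [localConj] at ha ⊢
    rw [ha]; simp [mul_assoc]
  rw [Ad, e.fderiv_eq]
  have := hasFDerivAt_localConj (E := E) h
  rw [← localConj_origin k] at this
  exact (this.comp _ (hasFDerivAt_localConj (E := E) k)).fderiv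

/-! ### The multiplication to second order -/

variable (G) in
/-- The differential of left multiplication by `param a` at the identity, in coordinates. -/
def leftDeriv (a : E) : E →L[ℝ] E :=
  (fderiv ℝ (localMul G : E × E → E) (a, origin G)).comp (ContinuousLinearMap.inr ℝ E E)

variable (G) in
/-- The differential of right multiplication by `param a` at the identity, in coordinates. -/
def rightDeriv (a : E) : E →L[ℝ] E :=
  (fderiv ℝ (localMul G : E × E → E) (origin G, a)).comp (ContinuousLinearMap.inl ℝ E E)

lemma eventually_differentiableAt_localMul :
    ∀ᶠ z in 𝓝 ((origin G, origin G) : E × E), DifferentiableAt ℝ (localMul G : E × E → E) z := by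
  have h := (contDiffAt_localMul (E := E) (G := G)).of_le (m := 1) (by simp)
  filter_upwards [h.eventually (by simp)] with z hz
  exact hz.differentiableAt (by simp)

lemma eventually_hasFDerivAt_leftDeriv : ∀ᶠ a in 𝓝 (origin G : E),
    HasFDerivAt (fun b => localMul G (a, b)) (leftDeriv G a) (origin G) := by
  filter_upwards [tendsto_prod_origin_right.eventually
    (eventually_differentiableAt_localMul (E := E) (G := G))] with a ha
  exact ha.hasFDerivAt.comp _ (hasFDerivAt_prodMk_right a (origin G : E))

lemma eventually_hasFDerivAt_rightDeriv : ∀ᶠ a in 𝓝 (origin G : E),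
    HasFDerivAt (fun b => localMul G (b, a)) (rightDeriv G a) (origin G) := by
  filter_upwards [tendsto_prod_origin_left.eventually
    (eventually_differentiableAt_localMul (E := E) (G := G))] with a ha
  exact HasFDerivAt.comp (f := fun b : E => (b, a)) _ ha.hasFDerivAt
    (hasFDerivAt_prodMk_left (origin G : E) a)

lemma leftDeriv_origin : leftDeriv G (origin G : E) = ContinuousLinearMap.id ℝ E :=
  (eventually_hasFDerivAt_leftDeriv.self_of_nhds).unique
    ((hasFDerivAt_id _).congr_of_eventuallyEq localMul_origin_left)

lemma rightDeriv_origin : rightDeriv G (origin G : E) = ContinuousLinearMap.id ℝ E :=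
  (eventually_hasFDerivAt_rightDeriv.self_of_nhds).unique
    ((hasFDerivAt_id _).congr_of_eventuallyEq localMul_origin_right)

variable (G) in
/-- The second differential of the multiplication at the identity, in coordinates. -/
def hessMul : E × E →L[ℝ] E × E →L[ℝ] E :=
  fderiv ℝ (fderiv ℝ (localMul G : E × E → E)) (origin G, origin G)

lemma hasFDerivAt_fderiv_localMul :
    HasFDerivAt (fderiv ℝ (localMul G : E × E → E)) (hessMul G) (origin G, origin G) := by
  have h := ((contDiffAt_localMul (E := E) (G := G)).of_le (m := 2)
    (WithTop.coe_le_coe.2 le_top)).fderiv_right (m := 1) (by norm_num)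
  exact (h.differentiableAt (by simp)).hasFDerivAt

lemma hessMul_symm (z w : E × E) : hessMul G z w = hessMul G w z := by
  have h := ((contDiffAt_localMul (E := E) (G := G)).of_le (m := 2)
    (WithTop.coe_le_coe.2 le_top)).isSymmSndFDerivAt (by simp)
  exact h z w

lemma hasFDerivAt_leftDeriv_apply (Y : E) :
    HasFDerivAt (fun a => leftDeriv G a Y)
      (((hessMul G).flip (0, Y)).comp (ContinuousLinearMap.inl ℝ E E)) (origin G) := by
  have h := HasFDerivAt.comp (f := fun a : E => (a, (origin G : E))) (origin G : E)
    (hasFDerivAt_fderiv_localMul (E := E) (G := G))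
    (hasFDerivAt_prodMk_left (origin G : E) (origin G))
  exact (h.clm_apply (hasFDerivAt_const ((0, Y) : E × E) _)).congr_fderiv (by ext; simp)

lemma hasDerivWithinAt_leftDeriv {c : ℝ → E} {X : E} {S : Set ℝ} {t : ℝ}
    (hc : HasDerivWithinAt c X S t) (h0 : c t = origin G) :
    HasDerivWithinAt (fun s => leftDeriv G (c s))
      ((hessMul G (X, 0)).comp (ContinuousLinearMap.inr ℝ E E)) S t := by
  have h1 : HasDerivWithinAt (fun s => (c s, (origin G : E))) (X, 0) S t :=
    hc.prodMk (hasDerivWithinAt_const _ _ _)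
  have h2 := HasFDerivAt.comp_hasDerivWithinAt_of_eq t
    (hasFDerivAt_fderiv_localMul (E := E) (G := G)) h1 (by rw [h0])
  exact (((ContinuousLinearMap.compL ℝ E (E × E) E).flip
    (ContinuousLinearMap.inr ℝ E E)).hasFDerivAt.comp_hasDerivWithinAt t h2)

lemma hasDerivWithinAt_rightDeriv {c : ℝ → E} {X : E} {S : Set ℝ} {t : ℝ}
    (hc : HasDerivWithinAt c X S t) (h0 : c t = origin G) :
    HasDerivWithinAt (fun s => rightDeriv G (c s))
      ((hessMul G (0, X)).comp (ContinuousLinearMap.inl ℝ E E)) S t := by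
  have h1 : HasDerivWithinAt (fun s => ((origin G : E), c s)) (0, X) S t :=
    (hasDerivWithinAt_const _ _ _).prodMk hc
  have h2 := HasFDerivAt.comp_hasDerivWithinAt_of_eq t
    (hasFDerivAt_fderiv_localMul (E := E) (G := G)) h1 (by rw [h0])
  exact (((ContinuousLinearMap.compL ℝ E (E × E) E).flip
    (ContinuousLinearMap.inl ℝ E E)).hasFDerivAt.comp_hasDerivWithinAt t h2)

/-- Multiplication is addition to first order at the identity. -/
lemma hasDerivWithinAt_coord_mul {γ η : ℝ → G} {v w : E} {S : Set ℝ} {t : ℝ}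
    (hγ : HasDerivWithinAt (fun s => (coord (γ s) : E)) v S t)
    (hη : HasDerivWithinAt (fun s => (coord (η s) : E)) w S t)
    (hγc : ContinuousWithinAt γ S t) (hηc : ContinuousWithinAt η S t)
    (hγ1 : γ t = 1) (hη1 : η t = 1) :
    HasDerivWithinAt (fun s => (coord (γ s * η s) : E)) (v + w) S t := by
  have hd := (eventually_differentiableAt_localMul (E := E) (G := G)).self_of_nhds.hasFDerivAt
  have h1 := hd.comp_hasDerivWithinAt_of_eq t (hγ.prodMk hη) (by simp [hγ1, hη1, coord_one])
  rw [ContinuousWithinAt, hγ1] at hγc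
  rw [ContinuousWithinAt, hη1] at hηc
  refine (h1.congr_of_eventuallyEq ?_ ?_).congr_deriv ?_
  · filter_upwards [hγc.eventually (eventually_param_coord (E := E)),
      hηc.eventually (eventually_param_coord (E := E))] with s h1 h2
    simp [localMul, h1, h2]
  · simp [localMul, hγ1, hη1, coord_one]
  · have hl := congrArg (fun L : E →L[ℝ] E => L w) (leftDeriv_origin (E := E) (G := G))
    have hr := congrArg (fun L : E →L[ℝ] E => L v) (rightDeriv_origin (E := E) (G := G))
    simp only [leftDeriv, rightDeriv, ContinuousLinearMap.comp_apply, ContinuousLinearMap.inl_apply,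
      ContinuousLinearMap.inr_apply, ContinuousLinearMap.id_apply] at hl hr
    have : ((v, w) : E × E) = (v, 0) + (0, w) := by simp
    rw [this, map_add, hl, hr]

/-! ### The adjoint action and the Lie bracket -/

/-- Left multiplication by `h` is conjugation by `h` followed by right multiplication by `h`. -/
lemma eventually_rightDeriv_comp_Ad : ∀ᶠ h in 𝓝 (1 : G),
    (rightDeriv G (coord h : E)).comp (Ad h) = leftDeriv G (coord h) := by
  filter_upwards [tendsto_coord.eventually (eventually_hasFDerivAt_leftDeriv (E := E) (G := G)),
    tendsto_coord.eventually (eventually_hasFDerivAt_rightDeriv (E := E) (G := G)),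
    eventually_param_coord (E := E) (G := G)] with h hl hr hh
  have e : (fun a : E => localMul G (localConj h a, coord h)) =ᶠ[𝓝 (origin G)]
      fun a => localMul G (coord h, a) := by
    filter_upwards [eventually_param_localConj (E := E) h] with a ha
    simp [localMul, ha, hh]
  rw [← localConj_origin h] at hr
  exact (hr.comp _ (hasFDerivAt_localConj (E := E) h)).unique
    (hl.congr_of_eventuallyEq e)

variable (G) in
/-- The Lie bracket of the Lie algebra of `G`, as an operation on the model space. -/
def modelBracket (X Y : E) : E :=
  (⁅(show GroupLieAlgebra 𝓘(ℝ, E) G from X), (show GroupLieAlgebra 𝓘(ℝ, E) G from Y)⁆ :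
    GroupLieAlgebra 𝓘(ℝ, E) G)

/-- The Lie bracket in terms of the second differential of the multiplication. -/
lemma modelBracket_eq_hessMul (X Y : E) :
    modelBracket G X Y = hessMul G (X, 0) (0, Y) - hessMul G (0, X) (Y, 0) := by
  have hM : IsManifold 𝓘(ℝ, E) 1 G := IsManifold.of_le (n := ∞) (by simp)
  -- in coordinates, the left-invariant field of `Y` is `a ↦ leftDeriv G a Y`
  have key : ∀ Y : GroupLieAlgebra 𝓘(ℝ, E) G,
      (VectorField.mpullbackWithin 𝓘(ℝ, E) 𝓘(ℝ, E) (extChartAt 𝓘(ℝ, E) (1 : G)).symm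
        (mulInvariantVectorField Y) (range 𝓘(ℝ, E)) : E → E) =ᶠ[𝓝 (origin G)]
        fun a => leftDeriv G a Y := by
    intro Y
    have hP : ∀ᶠ z in 𝓝 ((origin G, origin G) : E × E),
        param G (localMul G z) = param G z.1 * param G z.2 := by
      have hG : IsTopologicalGroup G := topologicalGroup_of_lieGroup 𝓘(ℝ, E) ∞
      have : Tendsto (fun z : E × E => param G z.1 * param G z.2)
          (𝓝 (origin G, origin G)) (𝓝 1) := by
        have h1 := (tendsto_param (E := E) (G := G)).comp
          (continuous_fst.tendsto ((origin G, origin G) : E × E))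
        have h2 := (tendsto_param (E := E) (G := G)).comp
          (continuous_snd.tendsto ((origin G, origin G) : E × E))
        simpa using h1.mul h2
      exact this.eventually eventually_param_coord
    filter_upwards [tendsto_prod_origin_right.eventually hP.eventually_nhds,
      eventually_hasFDerivAt_leftDeriv (E := E) (G := G),
      localMul_origin_right (E := E) (G := G),
      extChartAt_target_mem_nhds (I := 𝓘(ℝ, E)) (1 : G)] with a ha hl h0 hmem
    have hinv := isInvertible_mfderivWithin_extChartAt_symm (I := 𝓘(ℝ, E)) hmem
    have hpar : MDifferentiableAt 𝓘(ℝ, E) 𝓘(ℝ, E) (param G : E → G) a := by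
      have := (contMDiffOn_extChartAt_symm (I := 𝓘(ℝ, E)) (n := 1) (1 : G)).contMDiffAt
        ((isOpen_extChartAt_target (I := 𝓘(ℝ, E)) (1 : G)).mem_nhds hmem)
      exact this.mdifferentiableAt (by simp)
    have e : (fun b : E => param G (localMul G (a, b))) =ᶠ[𝓝 (origin G)]
        fun b => param G a * param G b := by
      have : Continuous (fun b : E => (a, b)) := by fun_prop
      exact (this.tendsto (origin G)).eventually ha
    have d1 := hasMFDerivAt_comp_of_eq hpar.hasMFDerivAt hl.hasMFDerivAt h0
    have d2 := hasMFDerivAt_comp_of_eq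
      ((contMDiff_mul_left (I := 𝓘(ℝ, E)) (n := ∞) (a := param G a)).mdifferentiableAt
        (x := 1) (by simp)).hasMFDerivAt (hasMFDerivAt_param (E := E)) (by simp)
    -- differentiate `param (localMul (a, b)) = param a * param b` in `b`
    have d3 := hasMFDerivAt_unique d1 (d2.congr_of_eventuallyEq e)
    have d4 : (mfderiv 𝓘(ℝ, E) 𝓘(ℝ, E) (param G : E → G) a : E →L[ℝ] E) (leftDeriv G a Y) =
        mulInvariantVectorField Y (param G a) := congrArg (fun L : E →L[ℝ] E => L Y) d3
    simp only [modelWithCornersSelf_coe, range_id, mfderivWithin_univ] at hinv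
    simp only [modelWithCornersSelf_coe, range_id, VectorField.mpullbackWithin_univ]
    rw [VectorField.mpullback_apply]
    obtain ⟨A, hA⟩ := hinv
    let B : E ≃L[ℝ] E := A
    have hB : (B : E →L[ℝ] E) = mfderiv 𝓘(ℝ, E) 𝓘(ℝ, E) (param G : E → G) a := hA
    rw [← hA, ContinuousLinearMap.inverse_equiv]
    change B.symm (mulInvariantVectorField Y (param G a)) = leftDeriv G a Y
    rw [← d4, ← hB]
    exact B.symm_apply_apply _
  have hd : ∀ Z : E, fderiv ℝ (fun a => leftDeriv G a Z) (origin G) =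
      ((hessMul G).flip (0, Z)).comp (ContinuousLinearMap.inl ℝ E E) :=
    fun Z => (hasFDerivAt_leftDeriv_apply Z).fderiv
  rw [modelBracket, GroupLieAlgebra.bracket_def, ← VectorField.mlieBracketWithin_univ,
    VectorField.mlieBracketWithin_apply, mfderiv_extChartAt_self]
  have hs : ((extChartAt 𝓘(ℝ, E) (1 : G)).symm ⁻¹' univ ∩ range 𝓘(ℝ, E)) = univ := by simp
  rw [hs]
  have e1 : VectorField.lieBracketWithin ℝ
      (VectorField.mpullbackWithin 𝓘(ℝ, E) 𝓘(ℝ, E) (extChartAt 𝓘(ℝ, E) (1 : G)).symm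
        (mulInvariantVectorField X) (range 𝓘(ℝ, E)))
      (VectorField.mpullbackWithin 𝓘(ℝ, E) 𝓘(ℝ, E) (extChartAt 𝓘(ℝ, E) (1 : G)).symm
        (mulInvariantVectorField Y) (range 𝓘(ℝ, E))) univ (origin G : E) =
      VectorField.lieBracket ℝ (fun a => leftDeriv G a X) (fun a => leftDeriv G a Y)
        (origin G : E) :=
    (congrFun VectorField.lieBracketWithin_univ _).trans ((key X).lieBracket_vectorField_eq (key Y))
  refine (congrArg _ e1).trans ?_
  have e2 : VectorField.lieBracket ℝ (fun a : E => leftDeriv G a X) (fun a => leftDeriv G a Y)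
      (origin G : E) = hessMul G (X, 0) (0, Y) - hessMul G (0, X) (Y, 0) := by
    rw [VectorField.lieBracket, hd X, hd Y, leftDeriv_origin, hessMul_symm (0, X)]
    simp
  rw [e2]
  exact congrArg (fun L : E →L[ℝ] E => L _) ContinuousLinearMap.inverse_id

/-- Along a curve through the identity, the adjoint action has the bracket as derivative: near the
identity it is the quotient of the differentials of left and right multiplication, whose
derivatives are the two terms of the bracket in `modelBracket_eq_hessMul`. -/
theorem hasDerivWithinAt_Ad [CompleteSpace E] {h : ℝ → G} {X : E}
    {S : Set ℝ} {t : ℝ} (hc : HasDerivWithinAt (fun s => (coord (h s) : E)) X S t) (h0 : h t = 1)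
    (hcont : ContinuousWithinAt h S t) (Y : E) :
    HasDerivWithinAt (fun s => Ad (h s) Y) (modelBracket G X Y) S t := by
  have h0' : (coord (h t) : E) = origin G := by rw [h0, coord_one]
  have hA := hasDerivWithinAt_rightDeriv hc h0'
  have hB := hasDerivWithinAt_leftDeriv hc h0'
  have hA1 : rightDeriv G (coord (h t) : E) = 1 := by rw [h0', rightDeriv_origin]; rfl
  have hB1 : leftDeriv G (coord (h t) : E) = 1 := by rw [h0', leftDeriv_origin]; rfl
  have hI := hasFDerivAt_ringInverse (𝕜 := ℝ) (1 : (E →L[ℝ] E)ˣ)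
  have hprod := ((hI.comp_hasDerivWithinAt_of_eq t hA hA1.symm).clm_comp hB).clm_apply
    (hasDerivWithinAt_const t S Y)
  have hu : ∀ᶠ s in 𝓝[S] t, IsUnit (rightDeriv G (coord (h s) : E)) := by
    have := hA.continuousWithinAt
    refine this.eventually (Units.isOpen.mem_nhds ?_)
    change IsUnit (rightDeriv G (coord (h t) : E))
    rw [hA1]
    exact isUnit_one
  have hAd : ∀ᶠ s in 𝓝[S] t,
      (rightDeriv G (coord (h s) : E)).comp (Ad (h s)) = leftDeriv G (coord (h s)) := by
    rw [ContinuousWithinAt, h0] at hcont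
    exact hcont.eventually eventually_rightDeriv_comp_Ad
  refine (hprod.congr_of_eventuallyEq ?_ ?_).congr_deriv ?_
  · filter_upwards [hu, hAd] with s hs hs'
    rw [← hs']
    have := Ring.inverse_mul_cancel _ hs
    exact (congrArg (fun L : E →L[ℝ] E => L (Ad (h s) Y)) this).symm
  · simp only [Function.comp, hA1, hB1, Ring.inverse_one]; rw [h0, Ad_one]; rfl
  · rw [modelBracket_eq_hessMul]
    simp [hA1, hB1]
    abel

lemma modelBracket_sum_smul_left {ι : Type*} (s : Finset ι) (c : ι → ℝ) (v : ι → E) (Y : E) :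
    modelBracket G (∑ i ∈ s, c i • v i) Y = ∑ i ∈ s, c i • modelBracket G (v i) Y := by
  have h : ∀ X : E, modelBracket G X Y =
      (((hessMul G).flip (0, Y)).comp (ContinuousLinearMap.inl ℝ E E) -
        ((hessMul G).flip (Y, 0)).comp (ContinuousLinearMap.inr ℝ E E)) X := fun X => by
    simp [modelBracket_eq_hessMul]
  simp only [h, map_sum, map_smul]

lemma modelBracket_swap (X Y : E) : modelBracket G X Y = -modelBracket G Y X := by
  rw [modelBracket_eq_hessMul, modelBracket_eq_hessMul, hessMul_symm (X, 0), hessMul_symm (0, X)]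
  abel

lemma Ad_inv_comp_Ad (h : G) : (Ad h⁻¹ : E →L[ℝ] E).comp (Ad h) = ContinuousLinearMap.id ℝ E := by
  rw [← Ad_mul, inv_mul_cancel, Ad_one]

end LieGroupChart

namespace CarnotStructure

variable {E : Type*} [NormedAddCommGroup E] [NormedSpace ℝ E]
  {G : Type*} [TopologicalSpace G] [ChartedSpace E G] [Group G] {n k : ℕ}
  (F : CarnotStructure E G n k)

open LieGroupChart

/-! ### Linear algebra in the frame -/

/-- The frame of the Lie algebra, as a basis of the model space. -/
def modelBasis : Module.Basis (Fin n) ℝ E := F.basis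

/-- The element `∑_I ξ_I X_I` of the Lie algebra, as a vector of the model space. -/
def frameVec : (Fin n → ℝ) ≃ₗ[ℝ] E := F.modelBasis.equivFun.symm

lemma frameVec_apply (ξ : Fin n → ℝ) : F.frameVec ξ = ∑ I, ξ I • F.modelBasis I :=
  F.modelBasis.equivFun_symm_apply ξ

lemma frameVec_single (I : Fin n) : F.frameVec (Pi.single I 1) = F.modelBasis I := by
  simp [frameVec_apply, Pi.single_apply, ite_smul]

lemma leftField_eq (ξ : Fin n → ℝ) (g : G) : F.leftField ξ g =
    (mfderiv 𝓘(ℝ, E) 𝓘(ℝ, E) (g * ·) (1 : G) : E →L[ℝ] E) (F.frameVec ξ) := by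
  rw [frameVec_apply]
  rfl

include F in
lemma finiteDimensional : FiniteDimensional ℝ E :=
  Module.Basis.finiteDimensional_of_finite F.modelBasis

lemma structMatrix_eq (R I J : Fin n) : F.structMatrix R I J =
    F.modelBasis.repr (modelBracket G (F.modelBasis I) (F.modelBasis J)) R := rfl

lemma modelBracket_basis (I J : Fin n) :
    modelBracket G (F.modelBasis I) (F.modelBasis J) =
      F.frameVec fun R => F.structMatrix R I J := by
  rw [frameVec_apply]
  exact (F.modelBasis.sum_repr _).symm

lemma C_apply (Z : Fin n → ℝ) (I J : Fin n) :
    F.C Z I J = ∑ α with F.ord α ≠ 1, Z α * F.structMatrix α I J := by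
  simp [C, Matrix.sum_apply]

/-- A bracket with an element of the first layer raises the layer by one. -/
lemma structMatrix_eq_zero {R I J : Fin n} (hI : F.ord I = 1) (hR : F.ord R ≠ F.ord J + 1) :
    F.structMatrix R I J = 0 := by
  have h : ⁅F.basis I, F.basis J⁆ ∈ Submodule.span ℝ (F.basis '' {K | F.ord K = F.ord J + 1}) := by
    rw [← F.bracket_layer _ (F.one_le_ord J)]
    exact Submodule.subset_span ⟨_, Submodule.subset_span ⟨I, hI, rfl⟩, _,
      Submodule.subset_span ⟨J, rfl, rfl⟩, rfl⟩
  rw [Module.Basis.mem_span_image] at h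
  by_contra hne
  exact hR (h (Finsupp.mem_support_iff.2 hne))

lemma structMatrix_swap [LieGroup 𝓘(ℝ, E) ∞ G] (R I J : Fin n) :
    F.structMatrix R I J = -F.structMatrix R J I := by
  rw [structMatrix_eq, structMatrix_eq, modelBracket_swap, map_neg]
  rfl

/-- The matrices `C(Z)` are skew. -/
lemma dotProduct_C_mulVec_self [LieGroup 𝓘(ℝ, E) ∞ G] (Z u : Fin n → ℝ) :
    u ⬝ᵥ (F.C Z *ᵥ u) = 0 := by
  have hT : (F.C Z)ᵀ = -F.C Z := by
    ext I J
    simp only [Matrix.transpose_apply, Matrix.neg_apply, C_apply]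
    rw [← Finset.sum_neg_distrib]
    refine Finset.sum_congr rfl fun α _ => ?_
    rw [F.structMatrix_swap α J I]; ring
  have h : u ⬝ᵥ (F.C Z *ᵥ u) = -(u ⬝ᵥ (F.C Z *ᵥ u)) := by
    conv_lhs => rw [Matrix.dotProduct_mulVec, ← Matrix.mulVec_transpose, hT, Matrix.neg_mulVec,
      neg_dotProduct, dotProduct_comm]
  linarith

lemma projH_apply (ξ : Fin n → ℝ) (I : Fin n) :
    F.projH ξ I = if F.ord I = 1 then ξ I else 0 := rfl

lemma projV_apply (ξ : Fin n → ℝ) (I : Fin n) :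
    F.projV ξ I = if F.ord I = 1 then 0 else ξ I := rfl

lemma projV_eq_zero_iff {ξ : Fin n → ℝ} : F.projV ξ = 0 ↔ F.projH ξ = ξ := by
  simp only [funext_iff, projV_apply, projH_apply, Pi.zero_apply]
  refine forall_congr' fun I => ?_
  split_ifs <;> simp [eq_comm]

@[simp] lemma projH_projH (ξ : Fin n → ℝ) : F.projH (F.projH ξ) = F.projH ξ := by
  ext I; simp only [projH_apply]; split_ifs <;> rfl

lemma projH_neg (ξ : Fin n → ℝ) : F.projH (-ξ) = -F.projH ξ := by
  ext I; simp only [projH_apply, Pi.neg_apply]; split_ifs <;> simp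

lemma projV_neg (ξ : Fin n → ℝ) : F.projV (-ξ) = -F.projV ξ := by
  ext I; simp only [projV_apply, Pi.neg_apply]; split_ifs <;> simp

lemma projH_smul (c : ℝ) (ξ : Fin n → ℝ) : F.projH (c • ξ) = c • F.projH ξ := by
  ext I; simp [projH_apply]

lemma projV_smul (c : ℝ) (ξ : Fin n → ℝ) : F.projV (c • ξ) = c • F.projV ξ := by
  ext I; simp [projV_apply]

lemma projH_dotProduct (ξ η : Fin n → ℝ) : F.projH ξ ⬝ᵥ η = F.projH ξ ⬝ᵥ F.projH η := by
  simp only [dotProduct, projH_apply]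
  exact Finset.sum_congr rfl fun I _ => by split_ifs <;> simp

lemma C_projV (Z : Fin n → ℝ) : F.C (F.projV Z) = F.C Z := by
  refine Finset.sum_congr rfl fun α hα => ?_
  rw [projV_apply, if_neg (Finset.mem_filter.1 hα).2]

/-- On horizontal vectors, `C_H(Z)` is the horizontal part of `C(Z)`. -/
lemma CH_mulVec {u : Fin n → ℝ} (hu : F.projV u = 0) (Z : Fin n → ℝ) :
    F.CH Z *ᵥ u = F.projH (F.C Z *ᵥ u) := by
  ext I
  rw [projH_apply]
  split_ifs with hI
  · rw [Matrix.mulVec, Matrix.mulVec, dotProduct, dotProduct]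
    refine Finset.sum_congr rfl fun J _ => ?_
    by_cases hJ : F.ord J = 1
    · suffices h : F.CH Z I J = F.C Z I J by rw [h]
      simp only [CH, C_apply, Matrix.sum_apply, Matrix.smul_apply, Matrix.of_apply, hI, hJ,
        and_self, if_true, smul_eq_mul]
      refine Finset.sum_subset (fun α hα => ?_) fun α _ hα => ?_
      · simp only [Finset.mem_filter, Finset.mem_univ, true_and] at hα ⊢
        omega
      · simp only [Finset.mem_filter, Finset.mem_univ, true_and] at hα
        rw [F.structMatrix_eq_zero hI (by omega), mul_zero]
    · have : u J = 0 := by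
        have := congrFun hu J
        rwa [projV_apply, if_neg hJ] at this
      simp [this]
  · rw [Matrix.mulVec, dotProduct]
    refine Finset.sum_eq_zero fun J _ => ?_
    simp [CH, Matrix.sum_apply, hI]

lemma len_sq (ξ : Fin n → ℝ) : len ξ ^ 2 = ξ ⬝ᵥ ξ := by
  rw [len, Real.sq_sqrt (Finset.sum_nonneg fun _ _ => sq_nonneg _)]
  simp [dotProduct, sq]

lemma len_nonneg (ξ : Fin n → ℝ) : 0 ≤ len ξ := Real.sqrt_nonneg _

lemma len_pos {ξ : Fin n → ℝ} (h : ξ ≠ 0) : 0 < len ξ := by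
  refine (len_nonneg ξ).lt_of_ne' fun h0 => h ?_
  have := len_sq ξ
  rw [h0] at this
  exact dotProduct_self_eq_zero.1 (by linarith)

lemma len_smul (c : ℝ) (ξ : Fin n → ℝ) : len (c • ξ) = |c| * len ξ := by
  rw [len, len, ← Real.sqrt_sq_eq_abs, ← Real.sqrt_mul (sq_nonneg c), Finset.mul_sum]
  simp [mul_pow]

/-- A unit vector at which the linear function `⟨·, w⟩` is at least its supremum over the open
unit ball of horizontal vectors is the direction of the horizontal part of `w`. -/
lemma eq_horNormal_of_forall_le {p w : Fin n → ℝ} (hp : F.projV p = 0) (hp1 : len p = 1)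
    (hw : F.projH w ≠ 0)
    (h : ∀ ξ : Fin n → ℝ, F.projV ξ = 0 → len ξ < 1 → (ξ - p) ⬝ᵥ w ≤ 0) :
    p = F.horNormal w := by
  have hpH := F.projV_eq_zero_iff.1 hp
  set l := len (F.projH w) with hl
  have hlpos : 0 < l := len_pos hw
  have hll : F.projH w ⬝ᵥ F.projH w = l ^ 2 := (len_sq _).symm
  have hpw : p ⬝ᵥ w = p ⬝ᵥ F.projH w := by
    rw [← hpH, projH_dotProduct]
  have hle : ∀ c : ℝ, c ∈ Ioo (0 : ℝ) 1 → c * l ≤ p ⬝ᵥ w := by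
    intro c hc
    have h1 := h ((c * l⁻¹) • F.projH w) ?_ ?_
    · rw [sub_dotProduct, smul_dotProduct, projH_dotProduct, hll, smul_eq_mul] at h1
      have : c * l⁻¹ * l ^ 2 = c * l := by field_simp
      linarith
    · rw [projV_eq_zero_iff, projH_smul, projH_projH]
    · rw [len_smul, ← hl, abs_of_pos (mul_pos hc.1 (inv_pos.2 hlpos)), mul_assoc,
        inv_mul_cancel₀ hlpos.ne', mul_one]
      exact hc.2
  have hge : l ≤ p ⬝ᵥ w := by
    have ht : Tendsto (fun c : ℝ => c * l) (𝓝[<] 1) (𝓝 (1 * l)) :=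
      ((continuous_id.mul continuous_const).tendsto _).mono_left nhdsWithin_le_nhds
    rw [one_mul] at ht
    exact le_of_tendsto ht (by
      filter_upwards [Ioo_mem_nhdsLT (zero_lt_one' ℝ)] with c hc using hle c hc)
  have hd : (p - F.horNormal w) ⬝ᵥ (p - F.horNormal w) ≤ 0 := by
    have hpp : p ⬝ᵥ p = 1 := by rw [← len_sq, hp1]; norm_num
    simp only [horNormal, ← hl, sub_dotProduct, dotProduct_sub, smul_dotProduct, dotProduct_smul,
      hll, hpp, smul_eq_mul, dotProduct_comm (F.projH w) p, ← hpw]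
    have h2 : 1 ≤ l⁻¹ * (p ⬝ᵥ w) := by
      rw [inv_mul_eq_div, le_div_iff₀ hlpos]; linarith
    have h3 : l⁻¹ * (l⁻¹ * l ^ 2) = 1 := by field_simp
    linarith
  have h0 : (0 : ℝ) ≤ (p - F.horNormal w) ⬝ᵥ (p - F.horNormal w) := by
    rw [← len_sq]; positivity
  exact sub_eq_zero.1 (dotProduct_self_eq_zero.1 (le_antisymm hd h0))

/-- The normal rescaled to have a horizontal part of length one; it is the sum of the horizontal
unit normal and of the vertical part `ϖ`. -/
def scaledNormal (ν : Fin n → ℝ) : Fin n → ℝ :=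
  (len (F.projH ν))⁻¹ • ν

lemma projH_scaledNormal (ν : Fin n → ℝ) : F.projH (F.scaledNormal ν) = F.horNormal ν :=
  F.projH_smul _ _

lemma projV_scaledNormal (ν : Fin n → ℝ) : F.projV (F.scaledNormal ν) = F.vertNormal ν :=
  F.projV_smul _ _

/-! ### Curves, in the frame -/

/-- Following an arc of constant speed `c` on `[a, b]` increases the CC-distance by at most
`c (b - a)`. -/
lemma ccDist_le_of_arc {x₀ : G} {γ : ℝ → G} {u : ℝ → Fin n → ℝ} {a b c : ℝ}
    (h : F.IsHorizontalArc γ u a b) (hu : ∀ t ∈ Icc a b, len (u t) = c) :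
    F.ccDist x₀ (γ b) ≤ F.ccDist x₀ (γ a) + ENNReal.ofReal (c * (b - a)) := by
  have hint : ∫ t in a..b, len (u t) = c * (b - a) := by
    rw [intervalIntegral.integral_congr (g := fun _ => c)
      (fun t ht => hu t (by rwa [uIcc_of_le h.le] at ht))]
    simp [mul_comm]
  conv_rhs => rw [ccDist]
  simp only [ENNReal.iInf_add]
  refine le_iInf fun ℓ => le_iInf fun hℓ => ?_
  have hj := Joined.append x₀ ℓ γ u a b hℓ h
  rw [hint] at hj
  exact (iInf₂_le _ hj).trans ENNReal.ofReal_add_le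

lemma ccDist_self (x₀ : G) : F.ccDist x₀ x₀ = 0 := by
  refine le_antisymm ((iInf₂_le 0 (Joined.refl x₀)).trans ?_) bot_le
  simp

lemma leftField_one (ξ : Fin n → ℝ) : (F.leftField ξ (1 : G) : E) = F.frameVec ξ := by
  rw [leftField_eq]
  have e : (fun z : G => 1 * z) = id := by ext z; simp
  rw [e, mfderiv_id]
  rfl

lemma hasDerivWithinAt_dotProduct {u v : ℝ → Fin n → ℝ} {u' v' : Fin n → ℝ} {S : Set ℝ}
    {t : ℝ} (hu : HasDerivWithinAt u u' S t) (hv : HasDerivWithinAt v v' S t) :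
    HasDerivWithinAt (fun s => u s ⬝ᵥ v s) (u' ⬝ᵥ v t + u t ⬝ᵥ v') S t := by
  rw [hasDerivWithinAt_pi] at hu hv
  have := HasDerivWithinAt.fun_sum (u := Finset.univ) fun I _ => (hu I).fun_mul (hv I)
  simpa only [dotProduct, ← Finset.sum_add_distrib] using this

lemma hasDerivWithinAt_projH {w : ℝ → Fin n → ℝ} {w' : Fin n → ℝ} {S : Set ℝ} {t : ℝ}
    (h : HasDerivWithinAt w w' S t) :
    HasDerivWithinAt (fun s => F.projH (w s)) (F.projH w') S t := by
  rw [hasDerivWithinAt_pi] at h ⊢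
  intro I
  by_cases hI : F.ord I = 1
  · simpa [projH_apply, hI] using h I
  · simpa [projH_apply, hI] using hasDerivWithinAt_const t S (0 : ℝ)

lemma hasDerivWithinAt_projV {w : ℝ → Fin n → ℝ} {w' : Fin n → ℝ} {S : Set ℝ} {t : ℝ}
    (h : HasDerivWithinAt w w' S t) :
    HasDerivWithinAt (fun s => F.projV (w s)) (F.projV w') S t := by
  rw [hasDerivWithinAt_pi] at h ⊢
  intro I
  by_cases hI : F.ord I = 1
  · simpa [projV_apply, hI] using hasDerivWithinAt_const t S (0 : ℝ)
  · simpa [projV_apply, hI] using h I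

namespace IsNormalExtremal

variable {F} {x : ℝ → G} {P : ℝ → Fin n → ℝ} {r : ℝ}

lemma hasDerivWithinAt_projH (hx : F.IsNormalExtremal x P 0 r) {s : ℝ} (hs : s ∈ Icc 0 r) :
    HasDerivWithinAt (fun s => F.projH (P s))
      (-F.projH (F.C (P s) *ᵥ F.projH (P s))) (Icc 0 r) s := by
  have h := F.hasDerivWithinAt_projH (hx s hs).2
  rwa [C_projV, projH_neg] at h

lemma continuousOn_projH (hx : F.IsNormalExtremal x P 0 r) :
    ContinuousOn (fun s => F.projH (P s)) (Icc 0 r) :=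
  fun _ hs => (hx.hasDerivWithinAt_projH hs).continuousWithinAt

end IsNormalExtremal

variable [LieGroup 𝓘(ℝ, E) ∞ G]

/-- The frame is invariant under left translations. -/
lemma mfderiv_mul_left_leftField (g h : G) (ξ : Fin n → ℝ) :
    (mfderiv 𝓘(ℝ, E) 𝓘(ℝ, E) (g * ·) h : E →L[ℝ] E) (F.leftField ξ h) =
      F.leftField ξ (g * h) := by
  rw [leftField_eq, leftField_eq]
  have h1 := hasMFDerivAt_comp_of_eq (hasMFDerivAt_mul_left (E := E) g h)
    (hasMFDerivAt_mul_left (E := E) h 1) (mul_one h)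
  have h2 := hasMFDerivAt_mul_left (E := E) (g * h) 1
  have e : (fun z => g * (h * z)) = fun z : G => g * h * z := by ext z; rw [mul_assoc]
  rw [e] at h1
  exact congrArg (fun L : E →L[ℝ] E => L (F.frameVec ξ)) (hasMFDerivAt_unique h1 h2)

variable {F}

lemma HasVelocityWithinAt.const_mul {γ : ℝ → G} {ξ : Fin n → ℝ} {S : Set ℝ} {t : ℝ}
    (h : F.HasVelocityWithinAt γ ξ S t) (g : G) :
    F.HasVelocityWithinAt (fun s => g * γ s) ξ S t := by
  have h1 := HasMFDerivAt.comp_hasMFDerivWithinAt t (hasMFDerivAt_mul_left (E := E) g (γ t)) h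
  refine h1.congr_mfderiv (ContinuousLinearMap.ext fun (c : ℝ) => ?_)
  exact ((mfderiv 𝓘(ℝ, E) 𝓘(ℝ, E) (g * ·) (γ t) : E →L[ℝ] E).map_smul c
    (F.leftField ξ (γ t))).trans
    (congrArg (fun v : E => c • v) (F.mfderiv_mul_left_leftField g (γ t) ξ))

/-- Velocity in the frame, read off in coordinates around the identity. -/
lemma HasVelocityWithinAt.hasDerivWithinAt_coord {γ : ℝ → G} {ξ : Fin n → ℝ} {S : Set ℝ} {t : ℝ}
    (h : F.HasVelocityWithinAt γ ξ S t) (h1 : γ t = 1) :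
    HasDerivWithinAt (fun s => (coord (γ s) : E)) (F.frameVec ξ) S t := by
  have hc : HasMFDerivAt 𝓘(ℝ, E) 𝓘(ℝ, E) (coord : G → E) (γ t) (ContinuousLinearMap.id ℝ E) := by
    rw [h1]; exact hasMFDerivAt_coord
  have h2 := HasMFDerivAt.comp_hasMFDerivWithinAt t hc h
  let v : E := F.leftField ξ (γ t)
  have hv : v = F.frameVec ξ := by
    change (F.leftField ξ (γ t) : E) = _
    rw [h1, leftField_one]
  have h3 : HasFDerivWithinAt (fun s => (coord (γ s) : E))
      ((ContinuousLinearMap.id ℝ E).comp ((1 : ℝ →L[ℝ] ℝ).smulRight v)) S t := h2.hasFDerivWithinAt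
  refine h3.hasDerivWithinAt.congr_deriv ?_
  simpa using hv

/-- Integral curves of the frame through the identity. -/
lemma exists_hasVelocityWithinAt (F : CarnotStructure E G n k) (ξ : Fin n → ℝ) :
    ∃ e : ℝ → G, e 0 = 1 ∧ ∃ ε > 0, ∀ s ∈ Ioo (-ε) ε, ∀ S, F.HasVelocityWithinAt e ξ S s := by
  have := F.finiteDimensional
  have : CompleteSpace E := FiniteDimensional.complete ℝ E
  have hG : LieGroup 𝓘(ℝ, E) (minSmoothness ℝ 3) G := by
    rw [minSmoothness_of_isRCLikeNormedField]
    exact LieGroup.of_le (n := ∞) (WithTop.coe_le_coe.2 le_top)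
  have : IsManifold 𝓘(ℝ, E) 1 G := IsManifold.of_le (n := ∞) (by simp)
  have hv := contMDiffAt_mulInvariantVectorField (I := 𝓘(ℝ, E)) (G := G)
    (∑ I, ξ I • F.basis I) (g := 1)
  have h2 : 1 ≤ minSmoothness ℝ 2 := by
    rw [minSmoothness_of_isRCLikeNormedField]; norm_num
  obtain ⟨e, he, hint⟩ := exists_isMIntegralCurveAt_of_contMDiffAt_boundaryless 0
    (hv.of_le h2)
  rw [isMIntegralCurveAt_iff'] at hint
  obtain ⟨ε, hε, h⟩ := hint
  refine ⟨e, he, ε, hε, fun s hs S => ?_⟩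
  have hb : Metric.ball (0 : ℝ) ε ∈ 𝓝 s :=
    Metric.isOpen_ball.mem_nhds (by simpa [Real.ball_eq_Ioo] using hs)
  exact ((h s (mem_of_mem_nhds hb)).hasMFDerivAt hb).hasMFDerivWithinAt

/-! ### The normal of a CC-sphere along a normal extremal -/

/-- The infinitesimal coadjoint action of a horizontal vector `u` on a covector `w`, in the frame.
Brackets with `u` have no components in the first layer, so only the vertical part of `w`
matters. -/
lemma apply_modelBracket_frameVec {L : E →L[ℝ] ℝ} {w u : Fin n → ℝ}
    (hL : ∀ ξ, L (F.frameVec ξ) = ξ ⬝ᵥ w) (hu : F.projV u = 0) (I : Fin n) :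
    L (modelBracket G (F.frameVec u) (F.modelBasis I)) = (-(F.C w *ᵥ u)) I := by
  rw [frameVec_apply, modelBracket_sum_smul_left, map_sum, Pi.neg_apply, Matrix.mulVec, dotProduct,
    ← Finset.sum_neg_distrib]
  refine Finset.sum_congr rfl fun J _ => ?_
  rw [map_smul, modelBracket_basis, hL, smul_eq_mul]
  by_cases hJ : F.ord J = 1
  · have h : (fun R => F.structMatrix R J I) ⬝ᵥ w = -F.C w I J := by
      rw [dotProduct, C_apply, ← Finset.sum_neg_distrib, Finset.sum_filter]
      refine Finset.sum_congr rfl fun R _ => ?_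
      split_ifs with hR
      · rw [F.structMatrix_swap R I J]; ring
      · have := F.one_le_ord I
        rw [F.structMatrix_eq_zero hJ (by omega), zero_mul]
    rw [h]; ring
  · have : u J = 0 := by
      have := congrFun hu J
      rwa [projV_apply, if_neg hJ] at this
    simp [this]

/-- In the coordinates `a ↦ y * param a` around a regular point `y`, the CC-sphere is the zero set
of a function that is negative on the ball and whose differential is the outer unit normal. -/
lemma IsOuterUnitNormal.exists_coord {x₀ : G} {t : ℝ} {y : G} {ν : Fin n → ℝ}
    (h : F.IsOuterUnitNormal x₀ t y ν) : ∃ (φ : E → ℝ) (L : E →L[ℝ] ℝ),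
      HasStrictFDerivAt φ L (origin G) ∧ (∀ ξ, L (F.frameVec ξ) = ξ ⬝ᵥ ν) ∧ φ (origin G) = 0 ∧
      (∀ᶠ a in 𝓝 (origin G : E), F.ccDist x₀ (y * param G a) < ENNReal.ofReal t → φ a < 0) ∧
      ∀ᶠ a in 𝓝 (origin G : E), F.ccDist x₀ (y * param G a) = ENNReal.ofReal t ↔ φ a = 0 := by
  obtain ⟨f, hf, hneg, rfl⟩ := h
  -- dividing `f` by the length of its gradient makes its differential the unit normal
  have hlen : 0 < (len (F.grad f y))⁻¹ := inv_pos.2 (len_pos hf.grad_ne_zero)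
  set κ := (len (F.grad f y))⁻¹
  have htend : Tendsto (fun a : E => y * param G a) (𝓝 (origin G)) (𝓝 y) := by
    have hG : IsTopologicalGroup G := topologicalGroup_of_lieGroup 𝓘(ℝ, E) ∞
    simpa using (tendsto_param (E := E) (G := G)).const_mul y
  have hmf : HasMFDerivAt 𝓘(ℝ, E) 𝓘(ℝ, ℝ) f y (mfderiv 𝓘(ℝ, E) 𝓘(ℝ, ℝ) f y) :=
    (hf.contMDiffAt.mdifferentiableAt (by simp)).hasMFDerivAt
  have h1 := hasMFDerivAt_comp_of_eq
    (hasMFDerivAt_mul_left (E := E) y 1) (hasMFDerivAt_param (E := E) (G := G)) param_origin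
  have h2 := hasMFDerivAt_comp_of_eq hmf h1 (by simp)
  set L₀ : E →L[ℝ] ℝ := (mfderiv 𝓘(ℝ, E) 𝓘(ℝ, ℝ) f y : E →L[ℝ] ℝ).comp
    ((mfderiv 𝓘(ℝ, E) 𝓘(ℝ, E) (y * ·) (1 : G) : E →L[ℝ] E).comp
      (ContinuousLinearMap.id ℝ E)) with hL₀
  have hstrict : HasStrictFDerivAt (fun a : E => f (y * param G a)) L₀ (origin G) := by
    have hc : ContDiffAt ℝ 1 (fun a : E => f (y * param G a)) (origin G) := by
      rw [← contMDiffAt_iff_contDiffAt]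
      refine ContMDiffAt.comp_of_eq (y := y) hf.contMDiffAt ?_ (by simp)
      exact (contMDiffAt_const.mul (contMDiffAt_param (E := E) (G := G))).of_le
        (WithTop.coe_le_coe.2 le_top)
    have h3 := hc.hasStrictFDerivAt (by simp)
    have h4 : HasFDerivAt (fun a : E => f (y * param G a)) L₀ (origin G) := h2.hasFDerivAt
    rwa [h4.fderiv] at h3
  refine ⟨fun a => κ * f (y * param G a), κ • L₀, hstrict.const_mul κ, fun ξ => ?_, ?_, ?_, ?_⟩
  · rw [dotProduct_smul, smul_apply]
    congr 1
    simp only [frameVec_apply, map_sum, map_smul, dotProduct, smul_eq_mul]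
    rfl
  · have := hf.eventually_iff.self_of_nhds.1 hf.mem
    simp [this]
  · filter_upwards [htend.eventually hneg] with a ha hlt
    exact mul_neg_of_pos_of_neg hlen (ha hlt)
  · filter_upwards [htend.eventually hf.eventually_iff] with a ha
    rw [mul_eq_zero, or_iff_right hlen.ne']
    exact ha

namespace IsNormalExtremal

variable {x : ℝ → G} {P : ℝ → Fin n → ℝ} {r : ℝ}

/-- Normal extremals have constant speed. -/
lemma len_projH_eq (hx : F.IsNormalExtremal x P 0 r) {s : ℝ} (hs : s ∈ Icc 0 r) :
    len (F.projH (P s)) = len (F.projH (P 0)) := by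
  have hd : ∀ s ∈ Icc 0 r, HasDerivWithinAt (fun s => F.projH (P s) ⬝ᵥ F.projH (P s)) 0
      (Icc 0 r) s := by
    intro s hs
    have h := hx.hasDerivWithinAt_projH hs
    refine (hasDerivWithinAt_dotProduct h h).congr_deriv ?_
    rw [neg_dotProduct, dotProduct_neg, dotProduct_comm (F.projH (F.C _ *ᵥ _)),
      ← projH_dotProduct, dotProduct_C_mulVec_self]
    simp
  have hc : F.projH (P s) ⬝ᵥ F.projH (P s) = F.projH (P 0) ⬝ᵥ F.projH (P 0) := by
    refine constant_of_has_deriv_right_zero (fun s hs => (hd s hs).continuousWithinAt)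
      (fun s hs => ?_) s hs
    exact (hd s (Ico_subset_Icc_self hs)).mono_of_mem_nhdsWithin (Icc_mem_nhdsGE_of_mem hs)
  rw [← len_sq, ← len_sq] at hc
  exact (pow_left_inj₀ (len_nonneg _) (len_nonneg _) two_ne_zero).1 hc

/-- Left translates of the projection of a normal extremal are horizontal arcs. -/
lemma isHorizontalArc (hx : F.IsNormalExtremal x P 0 r) (g : G) {a b : ℝ} (ha : 0 ≤ a)
    (hab : a ≤ b) (hb : b ≤ r) :
    F.IsHorizontalArc (fun s => g * x s) (fun s => F.projH (P s)) a b where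
  le := hab
  continuousOn := hx.continuousOn_projH.mono (Icc_subset_Icc ha hb)
  horizontal _ _ := F.projV_eq_zero_iff.2 (F.projH_projH _)
  hasVelocity t ht :=
    (((hx t ⟨ha.trans ht.1, ht.2.trans hb⟩).1).const_mul g).mono (Icc_subset_Icc ha hb)

/-- Along a left translate of a unit-speed normal extremal the CC-distance grows at most like the
parameter. -/
lemma ccDist_mul_le (hx : F.IsNormalExtremal x P 0 r) (hunit : len (F.projH (P 0)) = 1)
    (x₀ g : G) {a b : ℝ} (ha : 0 ≤ a) (hab : a ≤ b) (hb : b ≤ r) :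
    F.ccDist x₀ (g * x b) ≤ F.ccDist x₀ (g * x a) + ENNReal.ofReal (b - a) := by
  have h := F.ccDist_le_of_arc (x₀ := x₀) (hx.isHorizontalArc g ha hab hb) (c := 1)
    (fun t ht => by rw [hx.len_projH_eq ⟨ha.trans ht.1, ht.2.trans hb⟩, hunit])
  simpa using h

lemma ccDist_le (hx : F.IsNormalExtremal x P 0 r) (hunit : len (F.projH (P 0)) = 1)
    {b : ℝ} (hb : b ∈ Icc 0 r) : F.ccDist (x 0) (x b) ≤ ENNReal.ofReal b := by
  simpa [ccDist_self] using hx.ccDist_mul_le hunit (x 0) 1 le_rfl hb.1 hb.2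

/-- First variation of the distance: leaving the extremal at time `t - h` along a horizontal
direction `ξ` shorter than the unit speed, one stays for a time `h` inside the ball of radius `t`;
so to first order `h (ξ - ẋ)` does not point out of the ball. -/
lemma sub_dotProduct_normal_nonpos (hx : F.IsNormalExtremal x P 0 r)
    (hunit : len (F.projH (P 0)) = 1) {t : ℝ} (ht : t ∈ Ioc 0 r) {ν : Fin n → ℝ}
    (hν : F.IsOuterUnitNormal (x 0) t (x t) ν) {ξ : Fin n → ℝ} (hξ : F.projV ξ = 0)
    (hξ1 : len ξ < 1) : (ξ - F.projH (P t)) ⬝ᵥ ν ≤ 0 := by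
  obtain ⟨φ, L, hφ, hL, hφ0, hneg, -⟩ := hν.exists_coord
  obtain ⟨e, he0, ε, hε, he⟩ := F.exists_hasVelocityWithinAt ξ
  have hmaps : MapsTo (fun h : ℝ => t - h) (Icc 0 t) (Icc 0 r) := fun h hh =>
    ⟨by linarith [hh.2], by linarith [hh.1, ht.2]⟩
  -- the two factors of the comparison curve `x (t - h) * e h = x t * ((x t)⁻¹ * x (t - h) * e h)`
  let γ : ℝ → G := fun h => (x t)⁻¹ * x (t - h)
  have hγ0 : γ 0 = 1 := by simp [γ]
  have hvel := ((hx t ⟨ht.1.le, ht.2⟩).1).const_mul (x t)⁻¹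
  have hγd : HasDerivWithinAt (fun h => (coord (γ h) : E)) (-F.frameVec (F.projH (P t)))
      (Icc 0 t) 0 := by
    have h1 := hvel.hasDerivWithinAt_coord (by simp)
    have h2 : HasDerivWithinAt (fun h : ℝ => t - h) (-1) (Icc 0 t) 0 := by
      simpa using (hasDerivWithinAt_id (0 : ℝ) (Icc 0 t)).const_sub t
    have h3 := HasDerivWithinAt.scomp_of_eq 0 h1 h2 hmaps (by simp)
    exact h3.congr_deriv (by simp)
  have hγc : ContinuousWithinAt γ (Icc 0 t) 0 := by
    have h2 : ContinuousWithinAt (fun h : ℝ => t - h) (Icc 0 t) 0 := by fun_prop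
    have h1 : ContinuousWithinAt (fun s => (x t)⁻¹ * x s) (Icc 0 r) (t - 0) := by
      rw [sub_zero]; exact hvel.1
    exact ContinuousWithinAt.comp (f := fun h : ℝ => t - h) h1 h2 hmaps
  have hev := he 0 (by simpa using hε) (Icc 0 t)
  have hd := hasDerivWithinAt_coord_mul hγd (hev.hasDerivWithinAt_coord he0) hγc hev.1 hγ0 he0
  have hc : Tendsto (fun h => γ h * e h) (𝓝[Icc 0 t] 0) (𝓝 1) := by
    have hG : IsTopologicalGroup G := topologicalGroup_of_lieGroup 𝓘(ℝ, E) ∞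
    have := hγc.mul hev.1
    rw [ContinuousWithinAt, Pi.mul_apply, hγ0, he0, mul_one] at this
    exact this
  have hφd := hφ.hasFDerivAt.comp_hasDerivWithinAt_of_eq 0 hd (by simp [hγ0, he0, coord_one])
  have hlt : ∀ᶠ h in 𝓝[Ioi (0 : ℝ)] 0, φ (coord (γ h * e h)) < 0 := by
    have hsub : 𝓝[Ioi (0 : ℝ)] 0 ≤ 𝓝[Icc 0 t] 0 := by
      rw [← nhdsWithin_Ioc_eq_nhdsGT ht.1]
      exact nhdsWithin_mono _ Ioc_subset_Icc_self
    have hc' := hc.mono_left hsub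
    filter_upwards [hc'.eventually (eventually_param_coord (E := E)),
      (tendsto_coord.comp hc').eventually hneg, Ioo_mem_nhdsGT (lt_min hε ht.1)] with h hp hn hh
    refine hn ?_
    simp only [Function.comp, hp]
    have hh0 : 0 < h := hh.1
    have hhε : h < ε := hh.2.trans_le (min_le_left _ _)
    have hht : h < t := hh.2.trans_le (min_le_right _ _)
    have harc : F.IsHorizontalArc (fun s => x (t - h) * e s) (fun _ => ξ) 0 h :=
      { le := hh0.le
        continuousOn := continuousOn_const
        horizontal := fun _ _ => hξ
        hasVelocity := fun s hs =>
          (he s ⟨by linarith [hs.1], by linarith [hs.2]⟩ _).const_mul _ }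
    have h1 := F.ccDist_le_of_arc (x₀ := x 0) harc (c := len ξ) (fun _ _ => rfl)
    rw [he0, mul_one, sub_zero] at h1
    have h2 := hx.ccDist_le hunit (hmaps ⟨hh0.le, hht.le⟩)
    have e1 : x t * (γ h * e h) = x (t - h) * e h := by simp [γ, mul_assoc]
    rw [e1]
    calc F.ccDist (x 0) (x (t - h) * e h)
        ≤ ENNReal.ofReal (t - h) + ENNReal.ofReal (len ξ * h) := h1.trans (by gcongr)
      _ = ENNReal.ofReal (t - h + len ξ * h) :=
        (ENNReal.ofReal_add (by linarith) (mul_nonneg (len_nonneg _) hh0.le)).symm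
      _ < ENNReal.ofReal t := by
        rw [ENNReal.ofReal_lt_ofReal_iff ht.1]
        nlinarith
  have hLle : L (-F.frameVec (F.projH (P t)) + F.frameVec ξ) ≤ 0 := by
    have hsub : HasDerivWithinAt (fun h => φ (coord (γ h * e h)))
        (L (-F.frameVec (F.projH (P t)) + F.frameVec ξ)) (Ioi 0) 0 := by
      refine (hφd.mono_of_mem_nhdsWithin ?_)
      rw [← nhdsWithin_Ioc_eq_nhdsGT ht.1]
      exact mem_of_superset self_mem_nhdsWithin Ioc_subset_Icc_self
    rw [hasDerivWithinAt_iff_tendsto_slope' (by simp)] at hsub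
    refine le_of_tendsto hsub ?_
    filter_upwards [hlt, self_mem_nhdsWithin] with h hh (h0 : 0 < h)
    rw [slope_def_field]
    have : φ (coord (γ 0 * e 0)) = 0 := by rw [hγ0, he0, mul_one, coord_one, hφ0]
    rw [this]
    exact div_nonpos_of_nonpos_of_nonneg (by linarith) (by linarith)
  rwa [← map_neg, ← map_add, hL, neg_add_eq_sub] at hLle

/-- The velocity of a unit-speed normal extremal is the horizontal unit normal of the CC-sphere. -/
theorem projH_eq_horNormal (hx : F.IsNormalExtremal x P 0 r)
    (hunit : len (F.projH (P 0)) = 1) {t : ℝ} (ht : t ∈ Ioc 0 r) {ν : Fin n → ℝ}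
    (hν : F.IsNoncharNormal (x 0) t (x t) ν) : F.projH (P t) = F.horNormal ν :=
  F.eq_horNormal_of_forall_le (F.projV_eq_zero_iff.2 (F.projH_projH _))
    (by rw [hx.len_projH_eq ⟨ht.1.le, ht.2⟩, hunit]) hν.2
    fun _ hξ hξ1 => hx.sub_dotProduct_normal_nonpos hunit ht hν.1 hξ hξ1

/-- Right multiplication by `x(s)⁻¹ x(s')` maps the sphere of radius `s` into the closed ball of
radius `s'`, and maps `x(s)` to a boundary point `x(s')`. By the Lagrange multiplier rule the
normals at the two points correspond, up to a factor, under right multiplication. -/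
lemma exists_normal_eq_smul_comp_Ad (hx : F.IsNormalExtremal x P 0 r)
    (hunit : len (F.projH (P 0)) = 1) {s s' : ℝ} (hs : s ∈ Ioc 0 r) (hs' : s' ∈ Ioc 0 r)
    (hss' : s ≤ s') {ν ν' : Fin n → ℝ} (hν : F.IsNoncharNormal (x 0) s (x s) ν)
    (hν' : F.IsNoncharNormal (x 0) s' (x s') ν') {M M' : E →L[ℝ] ℝ}
    (hM : ∀ ξ, M (F.frameVec ξ) = ξ ⬝ᵥ ν) (hM' : ∀ ξ, M' (F.frameVec ξ) = ξ ⬝ᵥ ν') :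
    ∃ c : ℝ, c ≠ 0 ∧ M = c • M'.comp (Ad ((x s')⁻¹ * x s)) := by
  have := F.finiteDimensional
  have : CompleteSpace E := FiniteDimensional.complete ℝ E
  obtain ⟨φ, L, hφ, hL, hφ0, -, hiff⟩ := hν.1.exists_coord
  obtain ⟨φ', L', hφ', hL', hφ0', hneg', hiff'⟩ := hν'.1.exists_coord
  have hLM : L = M := by
    ext v; obtain ⟨ξ, rfl⟩ := F.frameVec.surjective v; rw [hL, hM]
  have hLM' : L' = M' := by
    ext v; obtain ⟨ξ, rfl⟩ := F.frameVec.surjective v; rw [hL', hM']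
  subst hLM hLM'
  -- a covector whose components have a horizontal part is not zero
  have hν0 : ∀ {L : E →L[ℝ] ℝ} {ν : Fin n → ℝ}, (∀ ξ, L (F.frameVec ξ) = ξ ⬝ᵥ ν) →
      F.projH ν ≠ 0 → L ≠ 0 := by
    rintro L ν hL h rfl
    refine h ?_
    have h1 : ν ⬝ᵥ ν = 0 := by rw [← hL]; rfl
    rw [dotProduct_self_eq_zero.1 h1]
    ext I; simp [projH_apply]
  set h := (x s')⁻¹ * x s with hh
  -- around `x s` and `x s'`, right multiplication by `(x s)⁻¹ * x s'` is conjugation by `h`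
  have hconj : HasStrictFDerivAt (localConj h : E → E) (Ad h) (origin G) :=
    (contDiffAt_localConj h).hasStrictFDerivAt (by simp)
  have hcomp : HasStrictFDerivAt (fun a => φ' (localConj h a)) (L'.comp (Ad h)) (origin G) := by
    rw [← localConj_origin h] at hφ'
    exact hφ'.comp _ hconj
  have hmax : IsLocalMaxOn (fun a => φ' (localConj h a)) {a | φ a = φ (origin G)} (origin G) := by
    change ∀ᶠ a in 𝓝[_] _, _
    rw [eventually_nhdsWithin_iff]
    filter_upwards [hiff, (tendsto_localConj (E := E) h).eventually hneg',
      (tendsto_localConj (E := E) h).eventually hiff', eventually_param_localConj (E := E) h]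
      with a h1 h2 h3 h4 ha
    rw [localConj_origin, hφ0']
    have hsa := h1.2 (ha.trans hφ0)
    have e : x s' * param G (localConj h a) = x s * param G a * (x s)⁻¹ * x s' := by
      rw [h4, hh]; group
    rw [e] at h2 h3
    have hle := hx.ccDist_mul_le hunit (x 0) (x s * param G a * (x s)⁻¹) hs.1.le hss' hs'.2
    rw [inv_mul_cancel_right, hsa, ← ENNReal.ofReal_add hs.1.le (by linarith),
      add_sub_cancel] at hle
    rcases hle.lt_or_eq with hlt | heq
    · exact (h2 hlt).le
    · exact (h3.1 heq).le
  have hextr : IsLocalExtrOn (fun a => φ' (localConj h a)) {a | φ a = φ (origin G)}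
      (origin G) := Or.inr hmax
  obtain ⟨a, b, hab, hsum⟩ := hextr.exists_multipliers_of_hasStrictFDerivAt_1d hφ hcomp
  have hne : L'.comp (Ad h) ≠ 0 := by
    intro h0
    refine hν0 hL' hν'.2 ?_
    have h1 := congrArg (fun T : E →L[ℝ] ℝ => T.comp (Ad h⁻¹)) h0
    have h2 := Ad_inv_comp_Ad (E := E) h⁻¹
    rw [inv_inv] at h2
    simpa [ContinuousLinearMap.comp_assoc, h2] using h1
  have hv : ∀ v, a * L v + b * L' (Ad h v) = 0 := fun v =>
    congrArg (fun T : E →L[ℝ] ℝ => T v) hsum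
  have ha : a ≠ 0 := by
    rintro rfl
    have hb : b ≠ 0 := fun hb => hab (by rw [hb, Prod.mk_zero_zero])
    refine hne (ContinuousLinearMap.ext fun v => ?_)
    simpa [hb] using hv v
  have hb : b ≠ 0 := by
    rintro rfl
    refine hν0 hL hν.2 (ContinuousLinearMap.ext fun v => ?_)
    simpa [ha] using hv v
  refine ⟨-(a⁻¹ * b), neg_ne_zero.2 (mul_ne_zero (inv_ne_zero ha) hb),
    ContinuousLinearMap.ext fun v => ?_⟩
  change L v = -(a⁻¹ * b) * L' (Ad h v)
  field_simp
  linarith [hv v]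

/-- Along a normal extremal, the normals of the CC-spheres are carried into each other, up to a
factor, by the coadjoint action. -/
lemma exists_normal_eq_smul (hx : F.IsNormalExtremal x P 0 r)
    (hunit : len (F.projH (P 0)) = 1) {s t : ℝ} (hs : s ∈ Ioc 0 r) (ht : t ∈ Ioc 0 r)
    {ν ν' : Fin n → ℝ} (hν : F.IsNoncharNormal (x 0) s (x s) ν)
    (hν' : F.IsNoncharNormal (x 0) t (x t) ν') {M : E →L[ℝ] ℝ}
    (hM : ∀ ξ, M (F.frameVec ξ) = ξ ⬝ᵥ ν') :
    ∃ c : ℝ, ν = c • fun I => M (Ad ((x t)⁻¹ * x s) (F.modelBasis I)) := by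
  obtain ⟨-, L, -, hL, -⟩ := hν.1.exists_coord
  suffices h : ∃ c : ℝ, L = c • M.comp (Ad ((x t)⁻¹ * x s)) by
    obtain ⟨c, hc⟩ := h
    refine ⟨c, funext fun I => ?_⟩
    have h1 := hL (Pi.single I 1)
    rw [frameVec_single, single_one_dotProduct] at h1
    rw [← h1, hc]
    rfl
  rcases le_total s t with hst | hts
  · obtain ⟨c, -, hc⟩ := hx.exists_normal_eq_smul_comp_Ad hunit hs ht hst hν hν' hL hM
    exact ⟨c, hc⟩
  · obtain ⟨c, hc0, hc⟩ := hx.exists_normal_eq_smul_comp_Ad hunit ht hs hts hν' hν hM hL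
    refine ⟨c⁻¹, ?_⟩
    have e : (x s)⁻¹ * x t = ((x t)⁻¹ * x s)⁻¹ := by group
    rw [hc, e, ContinuousLinearMap.smul_comp, ContinuousLinearMap.comp_assoc, Ad_inv_comp_Ad,
      smul_smul, inv_mul_cancel₀ hc0, one_smul, ContinuousLinearMap.comp_id]

/-- The rescaled normal of the CC-spheres solves the adjoint equation along the extremal. -/
theorem hasDerivWithinAt_scaledNormal (hx : F.IsNormalExtremal x P 0 r)
    (hunit : len (F.projH (P 0)) = 1) {ν : ℝ → Fin n → ℝ} {t : ℝ} (ht : t ∈ Ioc 0 r)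
    (hν : ∀ᶠ s in 𝓝[Ioc 0 r] t, F.IsNoncharNormal (x 0) s (x s) (ν s)) :
    HasDerivWithinAt (fun s => F.scaledNormal (ν s))
      (-(F.C (F.scaledNormal (ν t)) *ᵥ F.projH (P t))) (Ioc 0 r) t := by
  have := F.finiteDimensional
  have : CompleteSpace E := FiniteDimensional.complete ℝ E
  have htI : t ∈ Icc 0 r := Ioc_subset_Icc_self ht
  have hνt := hν.self_of_nhdsWithin ht
  have hPN : ∀ s ∈ Ioc 0 r, F.IsNoncharNormal (x 0) s (x s) (ν s) →
      F.projH (F.scaledNormal (ν s)) = F.projH (P s) := fun s hs h => by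
    rw [projH_scaledNormal, hx.projH_eq_horNormal hunit hs h]
  have hPP : ∀ s ∈ Ioc 0 r, F.projH (P s) ⬝ᵥ F.projH (P s) = 1 := fun s hs => by
    rw [← len_sq, hx.len_projH_eq (Ioc_subset_Icc_self hs), hunit, one_pow]
  have hNP : ∀ s ∈ Ioc 0 r, F.IsNoncharNormal (x 0) s (x s) (ν s) →
      F.scaledNormal (ν s) ⬝ᵥ F.projH (P s) = 1 := fun s hs h => by
    rw [dotProduct_comm, projH_dotProduct, hPN s hs h, hPP s hs]
  obtain ⟨-, L, -, hL, -⟩ := hνt.1.exists_coord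
  set κ := (len (F.projH (ν t)))⁻¹ with hκ
  have hκ0 : κ ≠ 0 := inv_ne_zero (len_pos hνt.2).ne'
  have hΛ : ∀ ξ, (κ • L) (F.frameVec ξ) = ξ ⬝ᵥ F.scaledNormal (ν t) := fun ξ => by
    rw [smul_apply, hL, scaledNormal, dotProduct_smul]
  -- the transported normal `q`, which is differentiable because the adjoint action is
  let q : ℝ → Fin n → ℝ := fun s I => (κ • L) (Ad ((x t)⁻¹ * x s) (F.modelBasis I))
  have hqt : q t = F.scaledNormal (ν t) := by
    funext I
    have := hΛ (Pi.single I 1)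
    rw [frameVec_single, single_one_dotProduct] at this
    simp only [q, inv_mul_cancel, Ad_one]
    exact this
  have hu : F.projV (F.projH (P t)) = 0 := F.projV_eq_zero_iff.2 (F.projH_projH _)
  have hvel := ((hx t htI).1).const_mul (x t)⁻¹
  have hq : HasDerivWithinAt q (-(F.C (F.scaledNormal (ν t)) *ᵥ F.projH (P t))) (Icc 0 r) t := by
    rw [hasDerivWithinAt_pi]
    intro I
    have h1 := hasDerivWithinAt_Ad (hvel.hasDerivWithinAt_coord (by simp)) (by simp) hvel.1
      (F.modelBasis I)
    have h2 := (κ • L).hasFDerivAt.comp_hasDerivWithinAt t h1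
    rwa [apply_modelBracket_frameVec hΛ hu] at h2
  -- the normalizing factor is stationary at `t`, because the matrices `C` are skew
  have hm : HasDerivWithinAt (fun s => q s ⬝ᵥ F.projH (P s)) 0 (Icc 0 r) t := by
    refine (hasDerivWithinAt_dotProduct hq (hx.hasDerivWithinAt_projH htI)).congr_deriv ?_
    rw [hqt, neg_dotProduct, dotProduct_comm _ (F.projH (P t)), dotProduct_C_mulVec_self,
      dotProduct_neg, dotProduct_comm, projH_dotProduct, hPN t ht hνt,
      dotProduct_comm, ← projH_dotProduct, dotProduct_C_mulVec_self]
    simp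
  have hmt : q t ⬝ᵥ F.projH (P t) = 1 := by rw [hqt, hNP t ht hνt]
  have hinv : HasDerivWithinAt (fun s => (q s ⬝ᵥ F.projH (P s))⁻¹) 0 (Icc 0 r) t :=
    (hm.fun_inv (by rw [hmt]; exact one_ne_zero)).congr_deriv (by simp)
  have hprod := (hinv.fun_smul hq).mono (Ioc_subset_Icc_self (a := (0 : ℝ)) (b := r))
  have heq : ∀ s ∈ Ioc 0 r, F.IsNoncharNormal (x 0) s (x s) (ν s) →
      F.scaledNormal (ν s) = (q s ⬝ᵥ F.projH (P s))⁻¹ • q s := by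
    intro s hs h
    obtain ⟨c, hc⟩ := hx.exists_normal_eq_smul hunit hs ht h hνt hL
    obtain ⟨d, hd⟩ : ∃ d : ℝ, F.scaledNormal (ν s) = d • q s := by
      refine ⟨(len (F.projH (ν s)))⁻¹ * (c * κ⁻¹), ?_⟩
      rw [scaledNormal, mul_smul]
      congr 1
      rw [hc]
      funext I
      simp only [q, Pi.smul_apply, smul_apply, smul_eq_mul]
      field_simp
    have h1 := hNP s hs h
    rw [hd, smul_dotProduct, smul_eq_mul] at h1
    rw [hd, eq_inv_of_mul_eq_one_left h1]
  refine (hprod.congr_of_eventuallyEq ?_ (heq t ht hνt)).congr_deriv ?_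
  · filter_upwards [hν, self_mem_nhdsWithin] with s h hs using heq s hs h
  · simp [hmt]

end IsNormalExtremal

end CarnotStructure

end

theorem mainTheorem2
    {E : Type*} [NormedAddCommGroup E] [NormedSpace ℝ E]
    {G : Type*} [TopologicalSpace G] [ChartedSpace E G] [Group G] [LieGroup 𝓘(ℝ, E) ∞ G]
    [SimplyConnectedSpace G] {n k : ℕ} (F : CarnotStructure E G n k)
    (hF : F.NoStrictlyAbnormalMinimizers)
    (x₀ : G) (r : ℝ) (x : ℝ → G) (P : ℝ → Fin n → ℝ)
    (hx : F.IsNormalExtremal x P 0 r) (hx₀ : x 0 = x₀)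
    (hunit : CarnotStructure.len (F.projH (P 0)) = 1)
    (ν : ℝ → Fin n → ℝ) (t : ℝ) (ht : t ∈ Set.Ioc 0 r) :
    (F.IsNoncharNormal x₀ t (x t) (ν t) →
      F.HasVelocityWithinAt x (F.horNormal (ν t)) (Set.Icc 0 r) t ∧
      ∀ ξ : Fin n → ℝ, F.projV ξ = 0 → ξ ⬝ᵥ ν t = 0 → ξ ⬝ᵥ F.projH (P t) = 0) ∧
    ((∀ᶠ s in 𝓝[Set.Ioc 0 r] t, F.IsNoncharNormal x₀ s (x s) (ν s)) →
      HasDerivWithinAt (fun s => F.horNormal (ν s))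
        (-(F.CH (F.vertNormal (ν t)) *ᵥ F.horNormal (ν t))) (Set.Ioc 0 r) t ∧
      HasDerivWithinAt (fun s => F.vertNormal (ν s))
        (-F.projV (F.C (F.vertNormal (ν t)) *ᵥ F.horNormal (ν t))) (Set.Ioc 0 r) t) := by
  subst hx₀
  refine ⟨fun hν => ?_, fun hν => ?_⟩
  · have h := hx.projH_eq_horNormal hunit ht hν
    refine ⟨h ▸ (hx t (Set.Ioc_subset_Icc_self ht)).1, fun ξ hξ h0 => ?_⟩
    rw [h, CarnotStructure.horNormal, dotProduct_smul, ← F.projV_eq_zero_iff.1 hξ,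
      ← F.projH_dotProduct, F.projV_eq_zero_iff.1 hξ, h0, smul_zero]
  · have h := hx.projH_eq_horNormal hunit ht (hν.self_of_nhdsWithin ht)
    have hN := hx.hasDerivWithinAt_scaledNormal hunit ht hν
    rw [h] at hN
    have hu : F.projV (F.horNormal (ν t)) = 0 :=
      F.projV_eq_zero_iff.2 (by rw [← h, F.projH_projH])
    rw [← F.projV_scaledNormal, F.CH_mulVec hu, F.C_projV, ← F.projH_neg, ← F.projV_neg]
    simp only [← F.projH_scaledNormal, ← F.projV_scaledNormal] at hN ⊢
    exact ⟨F.hasDerivWithinAt_projH hN, F.hasDerivWithinAt_projV hN⟩
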